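/- A tree is a partially ordered set $(V;\le)$ with a least element such that for every $x\in V$ the set $\{y\mid y\le x\}$ is finite and linearly ordered by $\le$. The level of $x$ is $|\{y\mid y<x\}|$, and the height of the tree is the supremum of the levels of its nodes. A recursive presentation of a tree is a pair of programs (Turing machines), halting on all inputs, that decide a set $D\subseteq\mathbb N$ and a relation $R\subseteq D\times D$ such that $(D;R)$ is a tree. For $n\in\mathbb N$, the isomorphism problem for recursive trees of height at most $n$ is the set of all pairs $(P_1,P_2)$ of recursive presentations of trees of height at most $n$ such that the trees presented by $P_1$ and $P_2$ are isomorphic. **Theorem.** For every $n\ge 1$, the isomorphism problem for recursive trees of height at most $n$ is $\Pi^0_{2n}$-complete; that is, it belongs to $\Pi^0_{2n}$ (as a set of pairs of pairs of programs), and every $\Pi^0_{2n}$ set of natural numbers is many-one reducible to it. Hardness does not come from recognizing valid presentations: for every $\Pi^0_{2n}$ set $B\subseteq\mathbb N$ there is a computable function $x\mapsto(P_1(x),P_2(x))$ such that, for every $x\in\mathbb N$, both $P_1(x)$ and $P_2(x)$ are recursive presentations of trees of height at most $n$, and $x\in B$ if and only if the trees presented by $P_1(x)$ and $P_2(x)$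 are isomorphic. -/

import Mathlib

open Nat.Partrec (Code)

namespace RecTree

/-! ## The arithmetical hierarchy -/

/-- `IsSigma0 k p`: the predicate `p` is in the class `Σ⁰_k`. The class `Σ⁰_0` consists of the
decidable predicates, and `p` is in `Σ⁰_{k+1}` iff `p a ↔ ∃ y, ¬ q (a, y)` for some `q` in `Σ⁰_k`,
that is, iff `p` is a projection of the complement of a `Σ⁰_k` predicate. -/
def IsSigma0 : ℕ → ∀ {α : Type} [Primcodable α], (α → Prop) → Prop
  | 0, _, _, p => ComputablePred p
  | k + 1, α, _, p => ∃ q : α × ℕ → Prop, IsSigma0 k q ∧ ∀ a, p a ↔ ∃ y, ¬ q (a, y)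

/-- `IsPi0 k p`: the complement of `p` is in `Σ⁰_k`. -/
def IsPi0 (k : ℕ) {α : Type} [Primcodable α] (p : α → Prop) : Prop :=
  IsSigma0 k fun a => ¬ p a

/-- `p` is `Π⁰_k`-complete: it is in `Π⁰_k`, and every `Π⁰_k` set of natural numbers is
many-one reducible to `p`. -/
def IsPi0Complete (k : ℕ) {α : Type} [Primcodable α] (p : α → Prop) : Prop :=
  IsPi0 k p ∧ ∀ B : ℕ → Prop, IsPi0 k B → ManyOneReducible B p

/-! ## Trees -/

/-- `(V; le)` is a tree: a partial order with a least element such that the elements below any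
given element form a finite linear order. -/
structure IsTree {V : Type} (le : V → V → Prop) : Prop where
  refl : ∀ x, le x x
  antisymm : ∀ x y, le x y → le y x → x = y
  trans : ∀ x y z, le x y → le y z → le x z
  exists_root : ∃ r, ∀ x, le r x
  finite_ancestors : ∀ x, {y | le y x}.Finite
  linear_ancestors : ∀ x y z, le y x → le z x → le y z ∨ le z y

/-- The level of `x`: the number of elements strictly below `x`. -/
noncomputable def level {V : Type} (le : V → V → Prop) (x : V) : ℕ∞ :=
  {y | le y x ∧ y ≠ x}.encard

/-- The height: the supremum of the levels. -/
noncomputable def height {V : Type} (le : V → V → Prop) : ℕ∞ :=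
  ⨆ x, level le x

/-! ## Recursive presentations -/

/-- The program `c` accepts the input `x`: it halts with output `1`. -/
def Accepts (c : Code) (x : ℕ) : Prop := c.eval x = Part.some 1

/-- The program `c` rejects the input `x`: it halts with output `0`. -/
def Rejects (c : Code) (x : ℕ) : Prop := c.eval x = Part.some 0

/-- The program `c` is a decision procedure: it accepts or rejects every input. -/
def IsDecider (c : Code) : Prop := ∀ x, Accepts c x ∨ Rejects c x

/-- A pair of programs, meant to decide the domain and the binary relation of a structure
`(D; R)` with `D ⊆ ℕ`, where pairs of naturals are coded by `Nat.pair`. -/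
abbrev Presentation := Code × Code

namespace Presentation

/-- The domain of the structure `S(P)`. -/
def Dom (P : Presentation) : Type := {x : ℕ // Accepts P.1 x}

/-- The binary relation of the structure `S(P)`. -/
def rel (P : Presentation) (a b : P.Dom) : Prop := Accepts P.2 (Nat.pair a.1 b.1)

/-- `P` really is a recursive presentation: its two programs decide a set `D ⊆ ℕ` and
a relation `R ⊆ D × D`. -/
structure IsValid (P : Presentation) : Prop where
  decides_dom : IsDecider P.1
  decides_rel : IsDecider P.2
  rel_subset : ∀ a b, Accepts P.2 (Nat.pair a b) → Accepts P.1 a ∧ Accepts P.1 b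

/-- `P` is a recursive presentation of a tree of height at most `n`. -/
def IsTreeOfHeightLE (n : ℕ) (P : Presentation) : Prop :=
  P.IsValid ∧ IsTree P.rel ∧ height P.rel ≤ n

/-- The structures presented by `P` and `Q` are isomorphic. -/
def Iso (P Q : Presentation) : Prop := Nonempty (P.rel ≃r Q.rel)

end Presentation

/-- The isomorphism problem for recursive trees of height at most `n`: the set of all pairs of
recursive presentations of isomorphic trees of height at most `n`. -/
def IsoProblem (n : ℕ) (p : Presentation × Presentation) : Prop :=
  p.1.IsTreeOfHeightLE n ∧ p.2.IsTreeOfHeightLE n ∧ p.1.Iso p.2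

end RecTree

/-! Upper bound: two trees are isomorphic iff the children of their roots can be matched so that
matched children have isomorphic cones. For countable sets of children and an equivalence relation,
a bijection exists iff, in both directions, every finite list of distinct children can be matched
with a list of distinct children on the other side, because this says that each class has the same
number of elements on both sides. For a relation in `Π⁰_{2k}` this finite matching condition has
the form `∀ ∃ Π⁰_{2k}`, so each level of the tree adds two quantifiers.

Lower bound: every `Π⁰_{2n}` predicate has the form `∃^∞ b₁ ⋯ ∃^∞ bₙ, R [b₁, …, bₙ]` with `R`
decidable. Such an `R` is coded by a tree of height at most `n` in which the cones above the
children of the root code the sections of `R` at the values of `b₁`; call `b₁` good if the remaining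
quantifiers hold for its section. In addition, for each `m`, the root has infinitely many children
coding the predicate `b₂ < m`, which has exactly `m` good values. With these, every finite number of
good values occurs infinitely often among the children anyway, so by induction the isomorphism type
of the tree depends only on the number of good `b₁`. In particular the tree is isomorphic to the one
coding the true predicate iff infinitely many `b₁` are good. -/

namespace RecTree

/-! ## The arithmetical hierarchy -/

section Computable

variable {α β γ : Type} [Primcodable α] [Primcodable β] [Primcodable γ]

attribute [fun_prop] Computable Computable.id Computable.const Computable.comp Computable.fst
  Computable.snd Computable.pair

@[fun_prop]
theorem computable_ofNat {δ : Type} [Denumerable δ] {f : α → ℕ} (hf : Computable f) :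
    Computable fun a => Denumerable.ofNat δ (f a) :=
  (Computable.ofNat δ).comp hf

@[fun_prop]
theorem computable_unpair {f : α → ℕ} (hf : Computable f) : Computable fun a => (f a).unpair :=
  Computable.unpair.comp hf

@[fun_prop]
theorem computable_natPair {f g : α → ℕ} (hf : Computable f) (hg : Computable g) :
    Computable fun a => Nat.pair (f a) (g a) :=
  Primrec₂.natPair.to_comp.comp hf hg

@[fun_prop]
theorem computable_length {f : α → List β} (hf : Computable f) :
    Computable fun a => (f a).length :=
  Computable.list_length.comp hf

@[fun_prop]
theorem computable_getD {f : α → List β} {g : α → ℕ} (d : β) (hf : Computable f)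
    (hg : Computable g) : Computable fun a => (f a).getD (g a) d :=
  (Primrec.list_getD d).to_comp.comp hf hg

theorem computablePred_const (P : Prop) : ComputablePred fun _ : α => P :=
  ⟨fun _ => Classical.dec P, Computable.const _⟩

theorem computablePred_eq {f g : α → β} (hf : Computable f) (hg : Computable g) :
    ComputablePred fun a => f a = g a := by
  classical
  exact (Primrec.eq.decide.to_comp.comp hf hg).computablePred

theorem computablePred_lt {f g : α → ℕ} (hf : Computable f) (hg : Computable g) :
    ComputablePred fun a => f a < g a := by
  classical
  exact (Primrec.nat_lt.decide.to_comp.comp hf hg).computablePred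

variable {p q : α → Prop}

theorem computablePred_comp (hp : ComputablePred p) {f : β → α} (hf : Computable f) :
    ComputablePred fun b => p (f b) := by
  classical
  exact (hp.decide.comp hf).computablePred

theorem computablePred_and (hp : ComputablePred p) (hq : ComputablePred q) :
    ComputablePred fun a => p a ∧ q a := by
  classical
  exact ComputablePred.computable_iff.2
    ⟨fun a => decide (p a) && decide (q a), Primrec.and.to_comp.comp hp.decide hq.decide, by simp⟩

theorem computablePred_or (hp : ComputablePred p) (hq : ComputablePred q) :
    ComputablePred fun a => p a ∨ q a :=
  (computablePred_and hp.not hq.not).not.of_eq fun a => by tauto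

theorem computablePred_forall_lt {p : α → ℕ → Prop}
    (hp : ComputablePred fun x : α × ℕ => p x.1 x.2) {f : α → ℕ} (hf : Computable f) :
    ComputablePred fun a => ∀ i < f a, p a i := by
  classical
  let check (a : α) (n : ℕ) : Bool := Nat.rec true (fun i b => decide (p a i) && b) n
  have check_eq_true (a : α) (n : ℕ) : check a n = true ↔ ∀ i < n, p a i := by
    induction n with
    | zero => simp [check]
    | succ n ih => rw [Nat.forall_lt_succ_right, ← ih]; simp [check, and_comm]
  refine ComputablePred.computable_iff.2
    ⟨fun a => check a (f a), ?_, funext fun a => propext (check_eq_true a (f a)).symm⟩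
  exact Computable.nat_rec (h := fun a (x : ℕ × Bool) => decide (p a x.1) && x.2)
    hf (Computable.const true) (Primrec.and.to_comp.comp
      (hp.decide.comp (g := fun x : α × ℕ × Bool => (x.1, x.2.1)) (by fun_prop)) (by fun_prop))

end Computable

section Hierarchy

variable {α β : Type} [Primcodable α] [Primcodable β] {k l : ℕ} {p q : α → Prop}

theorem isPi0_not_iff : IsPi0 k (fun a => ¬ p a) ↔ IsSigma0 k p := by
  simp [IsPi0]

theorem isPi0_zero_iff : IsPi0 0 p ↔ ComputablePred p :=
  ⟨fun h => by simpa using ComputablePred.not h, ComputablePred.not⟩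

theorem isSigma0_succ_iff :
    IsSigma0 (k + 1) p ↔ ∃ q : α → ℕ → Prop, IsPi0 k (fun x : α × ℕ => q x.1 x.2) ∧
      ∀ a, p a ↔ ∃ y, q a y := by
  constructor
  · rintro ⟨q, hq, h⟩
    exact ⟨fun a y => ¬ q (a, y), isPi0_not_iff.2 hq, h⟩
  · rintro ⟨q, hq, h⟩
    exact ⟨fun x => ¬ q x.1 x.2, hq, by simpa using h⟩

theorem isPi0_succ_iff :
    IsPi0 (k + 1) p ↔ ∃ q : α → ℕ → Prop, IsSigma0 k (fun x : α × ℕ => q x.1 x.2) ∧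
      ∀ a, p a ↔ ∀ y, q a y := by
  refine isSigma0_succ_iff.trans ⟨?_, ?_⟩ <;> rintro ⟨q, hq, h⟩
  · exact ⟨fun a y => ¬ q a y, hq, fun a => by simpa using not_congr (h a)⟩
  · exact ⟨fun a y => ¬ q a y, isPi0_not_iff.2 hq, fun a => by simpa using not_congr (h a)⟩

theorem IsSigma0.of_iff (hp : IsSigma0 k p) (h : ∀ a, q a ↔ p a) : IsSigma0 k q := by
  rwa [show q = p from funext fun a => propext (h a)]

theorem IsPi0.of_iff (hp : IsPi0 k p) (h : ∀ a, q a ↔ p a) : IsPi0 k q :=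
  IsSigma0.of_iff hp fun a => not_congr (h a)

theorem IsSigma0.comp (hp : IsSigma0 k p) {f : β → α} (hf : Computable f) :
    IsSigma0 k fun b => p (f b) := by
  induction k generalizing α β with
  | zero => exact computablePred_comp hp hf
  | succ k ih =>
    obtain ⟨q, hq, h⟩ := hp
    exact ⟨fun x => q (f x.1, x.2), ih hq (by fun_prop), fun b => h (f b)⟩

theorem IsPi0.comp (hp : IsPi0 k p) {f : β → α} (hf : Computable f) :
    IsPi0 k fun b => p (f b) :=
  IsSigma0.comp hp hf

theorem IsPi0.sigma_succ (hp : IsPi0 k p) : IsSigma0 (k + 1) p :=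
  isSigma0_succ_iff.2 ⟨fun a _ => p a, hp.comp Computable.fst, by simp⟩

theorem IsSigma0.succ (hp : IsSigma0 k p) : IsSigma0 (k + 1) p := by
  induction k generalizing α with
  | zero => exact (isPi0_zero_iff.2 hp).sigma_succ
  | succ k ih =>
    obtain ⟨q, hq, h⟩ := hp
    exact ⟨q, ih hq, h⟩

theorem IsSigma0.mono (hp : IsSigma0 k p) (h : k ≤ l) : IsSigma0 l p :=
  Nat.le_induction hp (fun _ _ => IsSigma0.succ) l h

theorem IsPi0.mono (hp : IsPi0 k p) (h : k ≤ l) : IsPi0 l p :=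
  IsSigma0.mono hp h

theorem isSigma0_and_or (hp : IsSigma0 k p) (hq : IsSigma0 k q) :
    IsSigma0 k (fun a => p a ∧ q a) ∧ IsSigma0 k (fun a => p a ∨ q a) := by
  induction k generalizing α with
  | zero => exact ⟨computablePred_and hp hq, computablePred_or hp hq⟩
  | succ k ih =>
    obtain ⟨p', hp', h₁⟩ := hp
    obtain ⟨q', hq', h₂⟩ := hq
    constructor
    · refine ⟨fun x => p' (x.1, x.2.unpair.1) ∨ q' (x.1, x.2.unpair.2),
        (ih (hp'.comp (by fun_prop)) (hq'.comp (by fun_prop))).2, fun a => ?_⟩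
      simp only [h₁, h₂, not_or]
      constructor
      · rintro ⟨⟨y, hy⟩, z, hz⟩
        exact ⟨Nat.pair y z, by simp [hy, hz]⟩
      · rintro ⟨w, hy, hz⟩
        exact ⟨⟨_, hy⟩, _, hz⟩
    · refine ⟨fun x => p' x ∧ q' x, (ih hp' hq').1, fun a => ?_⟩
      simp only [h₁, h₂, ← exists_or, not_and_or]

theorem IsSigma0.and (hp : IsSigma0 k p) (hq : IsSigma0 k q) : IsSigma0 k fun a => p a ∧ q a :=
  (isSigma0_and_or hp hq).1

theorem IsSigma0.or (hp : IsSigma0 k p) (hq : IsSigma0 k q) : IsSigma0 k fun a => p a ∨ q a :=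
  (isSigma0_and_or hp hq).2

theorem IsPi0.and (hp : IsPi0 k p) (hq : IsPi0 k q) : IsPi0 k fun a => p a ∧ q a :=
  IsSigma0.of_iff (IsSigma0.or hp hq) fun _ => not_and_or

theorem IsPi0.or (hp : IsPi0 k p) (hq : IsPi0 k q) : IsPi0 k fun a => p a ∨ q a :=
  IsSigma0.of_iff (IsSigma0.and hp hq) fun _ => not_or

theorem IsPi0.imp (hp : IsSigma0 k p) (hq : IsPi0 k q) : IsPi0 k fun a => p a → q a :=
  ((isPi0_not_iff.2 hp).or hq).of_iff fun _ => imp_iff_not_or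

theorem IsSigma0.exists_nat {p : α → ℕ → Prop} (hp : IsSigma0 (k + 1) fun x : α × ℕ => p x.1 x.2) :
    IsSigma0 (k + 1) fun a => ∃ y, p a y := by
  obtain ⟨q, hq, h⟩ := hp
  refine ⟨fun x => q ((x.1, x.2.unpair.1), x.2.unpair.2), hq.comp (by fun_prop), fun a => ?_⟩
  constructor
  · rintro ⟨y, hy⟩
    obtain ⟨z, hz⟩ := (h (a, y)).1 hy
    exact ⟨Nat.pair y z, by simpa using hz⟩
  · rintro ⟨w, hw⟩
    exact ⟨_, (h (a, _)).2 ⟨_, hw⟩⟩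

theorem IsSigma0.exists [Inhabited β] {p : α → β → Prop}
    (hp : IsSigma0 (k + 1) fun x : α × β => p x.1 x.2) : IsSigma0 (k + 1) fun a => ∃ y, p a y := by
  have decode_surjective :
      Function.Surjective fun n => (Encodable.decode n : Option β).getD default :=
    fun y => ⟨Encodable.encode y, by simp⟩
  refine (IsSigma0.exists_nat (p := fun a n => p a ((Encodable.decode n).getD default))
    (hp.comp (f := fun x : α × ℕ => (x.1, (Encodable.decode x.2).getD default)) ?_)).of_iff
    fun a => decode_surjective.exists
  exact Computable.fst.pair
    (Computable.option_getD (Computable.decode.comp Computable.snd) (Computable.const default))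

theorem IsPi0.forall [Inhabited β] {p : α → β → Prop}
    (hp : IsPi0 (k + 1) fun x : α × β => p x.1 x.2) : IsPi0 (k + 1) fun a => ∀ y, p a y :=
  IsSigma0.of_iff (IsSigma0.exists (p := fun a y => ¬ p a y) hp) fun _ => not_forall

/-- The class `Δ⁰_k = Σ⁰_k ∩ Π⁰_k`; unlike the other two classes, it is closed under negation and
implication. -/
def IsDelta0 (k : ℕ) (p : α → Prop) : Prop := IsSigma0 k p ∧ IsPi0 k p

theorem isDelta0_of_computablePred (hp : ComputablePred p) (k : ℕ) : IsDelta0 k p :=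
  ⟨IsSigma0.mono (k := 0) hp k.zero_le, (isPi0_zero_iff.2 hp).mono k.zero_le⟩

theorem isDelta0_eq {f g : α → β} (hf : Computable f) (hg : Computable g) (k : ℕ) :
    IsDelta0 k fun a => f a = g a :=
  isDelta0_of_computablePred (computablePred_eq hf hg) k

theorem IsPi0.isDelta0 (hp : IsPi0 k p) (h : k < l) : IsDelta0 l p :=
  ⟨hp.sigma_succ.mono h, hp.mono h.le⟩

theorem IsSigma0.isDelta0 (hp : IsSigma0 k p) (h : k < l) : IsDelta0 l p :=
  ⟨hp.mono h.le, (isPi0_not_iff.2 hp).sigma_succ.mono h⟩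

namespace IsDelta0

theorem not (hp : IsDelta0 k p) : IsDelta0 k fun a => ¬ p a := ⟨hp.2, isPi0_not_iff.2 hp.1⟩

theorem and (hp : IsDelta0 k p) (hq : IsDelta0 k q) : IsDelta0 k fun a => p a ∧ q a :=
  ⟨hp.1.and hq.1, hp.2.and hq.2⟩

theorem or (hp : IsDelta0 k p) (hq : IsDelta0 k q) : IsDelta0 k fun a => p a ∨ q a :=
  ⟨hp.1.or hq.1, hp.2.or hq.2⟩

theorem of_iff (hp : IsDelta0 k p) (h : ∀ a, q a ↔ p a) : IsDelta0 k q :=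
  ⟨hp.1.of_iff h, hp.2.of_iff h⟩

theorem imp (hp : IsDelta0 k p) (hq : IsDelta0 k q) : IsDelta0 k fun a => p a → q a :=
  (hp.not.or hq).of_iff fun _ => imp_iff_not_or

end IsDelta0

/-- The list `c` consists of witnesses for `r 0`, `r 1`, …, `r (c.length - 1)`. -/
def IsWitnessList (r : ℕ → ℕ → Prop) (c : List ℕ) : Prop :=
  ∀ i < c.length, r i (c.getD i 0)

theorem exists_isWitnessList_iff {r : ℕ → ℕ → Prop} {n : ℕ} :
    (∃ c : List ℕ, c.length = n ∧ IsWitnessList r c) ↔ ∀ i < n, ∃ y, r i y := by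
  constructor
  · rintro ⟨c, rfl, hc⟩ i hi
    exact ⟨_, hc i hi⟩
  · intro h
    choose! f hf using h
    refine ⟨(List.range n).map f, by simp, fun i hi => ?_⟩
    rw [List.getD_eq_getElem _ _ hi]
    simpa using hf i (by simpa using hi)

theorem IsWitnessList.eq_of_length_eq {r : ℕ → ℕ → Prop} (hr : ∀ i, {y | r i y}.Subsingleton)
    {c d : List ℕ} (hc : IsWitnessList r c) (hd : IsWitnessList r d) (h : c.length = d.length) :
    c = d := by
  refine List.ext_getElem h fun i hi hi' => ?_
  simpa [hi, hi'] using hr i (hc i hi) (hd i hi')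

theorem IsPi0.forall_lt {p : α → ℕ → Prop} (hp : IsPi0 k fun x : α × ℕ => p x.1 x.2) {f : α → ℕ}
    (hf : Computable f) : IsPi0 k fun a => ∀ i < f a, p a i := by
  cases k with
  | zero => exact isPi0_zero_iff.2 (computablePred_forall_lt (isPi0_zero_iff.1 hp) hf)
  | succ k =>
    refine IsPi0.forall (IsPi0.imp (isDelta0_of_computablePred ?_ _).1 hp)
    exact computablePred_lt Computable.snd (by fun_prop)

theorem isPi0_isWitnessList {r : α → ℕ → ℕ → Prop}
    (hr : IsPi0 k fun x : (α × ℕ) × ℕ => r x.1.1 x.1.2 x.2) :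
    IsPi0 k fun x : α × List ℕ => IsWitnessList (r x.1) x.2 :=
  IsPi0.forall_lt (hr.comp (f := fun x : (α × List ℕ) × ℕ => ((x.1.1, x.2), x.1.2.getD x.2 0))
    (by fun_prop)) (by fun_prop)

theorem IsSigma0.forall_lt {p : α → ℕ → Prop} (hp : IsSigma0 k fun x : α × ℕ => p x.1 x.2)
    {f : α → ℕ} (hf : Computable f) : IsSigma0 k fun a => ∀ i < f a, p a i := by
  cases k with
  | zero => exact computablePred_forall_lt hp hf
  | succ k =>
    obtain ⟨r, hr, h⟩ := isSigma0_succ_iff.1 hp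
    have hwit : IsPi0 k fun x : α × List ℕ =>
        x.2.length = f x.1 ∧ IsWitnessList (fun i y => r (x.1, i) y) x.2 :=
      IsPi0.and (isDelta0_eq (by fun_prop) (by fun_prop) k).2
        (isPi0_isWitnessList (r := fun a i y => r (a, i) y) hr)
    refine (IsSigma0.exists
      (p := fun a c => c.length = f a ∧ IsWitnessList (fun i y => r (a, i) y) c)
      hwit.sigma_succ).of_iff fun a => ?_
    rw [exists_isWitnessList_iff]
    exact forall₂_congr fun i _ => h (a, i)

/-- For `k = 0`, truncated subtraction makes the witness relation decidable. -/
theorem IsSigma0.exists_subsingleton_witness (hp : IsSigma0 k p) :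
    ∃ r : α → ℕ → Prop, IsPi0 (k - 1) (fun x : α × ℕ => r x.1 x.2) ∧
      (∀ a, p a ↔ ∃ y, r a y) ∧ ∀ a, {y | r a y}.Subsingleton := by
  induction k generalizing α with
  | zero =>
    refine ⟨fun a y => p a ∧ y = 0, isPi0_zero_iff.2 (computablePred_and
      (computablePred_comp hp Computable.fst) (computablePred_eq (by fun_prop) (by fun_prop))),
      fun a => by simp, ?_⟩
    rintro a y ⟨-, rfl⟩ z ⟨-, rfl⟩
    rfl
  | succ k ih =>
    -- A witness for `p a` codes the least `y` with `¬ q (a, y)`, as the length of the list of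
    -- the unique witnesses for `q (a, 0)`, …, `q (a, y - 1)`.
    obtain ⟨q, hq, h⟩ := hp
    obtain ⟨r, hr, hqr, hr_unique⟩ := ih hq
    let W (a : α) (c : List ℕ) : Prop := ¬ q (a, c.length) ∧ IsWitnessList (fun i => r (a, i)) c
    have hW : IsPi0 k fun x : α × List ℕ => W x.1 x.2 :=
      IsPi0.and (isPi0_not_iff.2 (hq.comp (f := fun x : α × List ℕ => (x.1, x.2.length))
        (by fun_prop)))
        ((isPi0_isWitnessList (r := fun a i y => r (a, i) y) hr).mono (k.sub_le 1))
    have hW_unique : ∀ a, {c | W a c}.Subsingleton := by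
      rintro a c ⟨hc, hc'⟩ d ⟨hd, hd'⟩
      refine hc'.eq_of_length_eq (fun i => hr_unique (a, i)) hd' (le_antisymm ?_ ?_) <;>
        refine le_of_not_gt fun hlt => ?_
      · exact hd ((hqr _).2 ⟨_, hc' _ hlt⟩)
      · exact hc ((hqr _).2 ⟨_, hd' _ hlt⟩)
    refine ⟨fun a y => W a (Denumerable.ofNat _ y),
      hW.comp (f := fun x : α × ℕ => (x.1, Denumerable.ofNat _ x.2)) (by fun_prop), fun a => ?_,
      fun a => (hW_unique a).preimage (Denumerable.eqv (List ℕ)).symm.injective⟩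
    refine (h a).trans (Iff.trans ?_ (Denumerable.eqv (List ℕ)).symm.surjective.exists)
    constructor
    · intro hy
      classical
      obtain ⟨c, hc, hcr⟩ := exists_isWitnessList_iff.2 fun i hi =>
        (hqr (a, i)).1 (not_not.1 (Nat.find_min hy hi))
      exact ⟨c, hc ▸ Nat.find_spec hy, hcr⟩
    · rintro ⟨c, hc, -⟩
      exact ⟨_, hc⟩

theorem infinite_isWitnessList_iff {r : ℕ → ℕ → Prop} (hr : ∀ i, {y | r i y}.Subsingleton) :
    {c | IsWitnessList r c}.Infinite ↔ ∀ i, ∃ y, r i y := by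
  constructor
  · intro hinf i
    by_contra hi
    refine hinf (Set.Finite.of_finite_image ((Set.finite_Iic i).subset ?_)
      fun c hc d hd => hc.eq_of_length_eq hr hd)
    rintro _ ⟨c, hc, rfl⟩
    exact le_of_not_gt fun hlt => hi ⟨_, hc i hlt⟩
  · intro h
    choose c hc hcr using fun n => exists_isWitnessList_iff.2 fun i (_ : i < n) => h i
    exact Set.infinite_of_injective_forall_mem
      (fun m n hmn => by simpa only [hc] using congrArg List.length hmn) hcr

theorem IsPi0.exists_infinite (hp : IsPi0 (k + 2) p) :
    ∃ q : α → ℕ → Prop, IsPi0 k (fun x : α × ℕ => q x.1 x.2) ∧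
      ∀ a, p a ↔ {y | q a y}.Infinite := by
  obtain ⟨q, hq, h⟩ := isPi0_succ_iff.1 hp
  obtain ⟨r, hr, hqr, hr_unique⟩ := hq.exists_subsingleton_witness
  refine ⟨fun a y => IsWitnessList (fun i => r (a, i)) (Denumerable.ofNat _ y),
    (isPi0_isWitnessList (r := fun a i y => r (a, i) y) hr).comp
      (f := fun x : α × ℕ => (x.1, Denumerable.ofNat _ x.2)) (by fun_prop), fun a => ?_⟩
  rw [h, forall_congr' fun i => hqr (a, i),
    ← infinite_isWitnessList_iff fun i => hr_unique (a, i)]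
  let e := (Denumerable.eqv (List ℕ)).symm
  exact not_congr ⟨fun h => h.preimage e.injective.injOn,
    fun h => .of_preimage (f := e) h e.surjective⟩

end Hierarchy

/-! ## Matching countable sets -/

section Matching

variable {α β : Type} {s : Set α} {t : Set β} {R : α → β → Prop}

theorem natCast_le_encard_iff {n : ℕ} :
    n ≤ s.encard ↔ ∃ l : List α, (l.Nodup ∧ ∀ a ∈ l, a ∈ s) ∧ l.length = n := by
  classical
  constructor
  · intro h
    obtain ⟨d, hds, hdn⟩ := Set.exists_subset_encard_eq h
    lift d to Finset α using Set.finite_of_encard_eq_coe hdn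
    exact ⟨d.toList, ⟨d.nodup_toList, fun a ha => hds (by simpa using ha)⟩, by simpa using hdn⟩
  · rintro ⟨l, ⟨hl, hls⟩, rfl⟩
    rw [← List.toFinset_card_of_nodup hl, ← Set.encard_coe_eq_coe_finsetCard]
    exact Set.encard_le_encard fun a ha => hls a (by simpa using ha)

theorem encard_le_natCast_iff {n : ℕ} :
    s.encard ≤ n ↔ ∀ l : List α, (l.Nodup ∧ ∀ a ∈ l, a ∈ s) → l.length ≤ n := by
  rw [← not_lt, ← ENat.add_one_le_iff (ENat.natCast_ne_top n), ← Nat.cast_one, ← Nat.cast_add,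
    natCast_le_encard_iff]
  constructor
  · intro h l hl
    by_contra! hlen
    refine h ⟨l.take (n + 1), ⟨hl.1.take, fun a ha => hl.2 a (List.mem_of_mem_take ha)⟩, ?_⟩
    simpa using hlen
  · rintro h ⟨l, hl, hlen⟩
    have := h l hl
    lia

/-- Finitely many distinct elements of `s` are always related by `R` to as many distinct elements
of `t`: the part of a perfect matching from `s` to `t` that can be expressed with finite lists. -/
def ListMatching (s : Set α) (t : Set β) (R : α → β → Prop) : Prop :=
  ∀ l : List α, l.Nodup ∧ (∀ a ∈ l, a ∈ s) →
    ∃ m : List β, (m.Nodup ∧ ∀ b ∈ m, b ∈ t) ∧ List.Forall₂ R l m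

theorem listMatching_of_equiv (e : s ≃ t) (he : ∀ a : s, R a (e a)) : ListMatching s t R := by
  rintro l ⟨hl, hls⟩
  lift l to List s using hls
  refine ⟨l.map fun a => (e a : β), ⟨?_, ?_⟩, ?_⟩
  · exact hl.of_map.map (Subtype.val_injective.comp e.injective)
  · simp only [List.mem_map]
    rintro _ ⟨a, -, rfl⟩
    exact (e a).2
  · rw [List.forall₂_map_left_iff, List.forall₂_map_right_iff, List.forall₂_same]
    exact fun a _ => he a

theorem listMatching_image_iff {A B : Type} {ι : A → α} {κ : B → β} (hι : ι.Injective)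
    (hκ : κ.Injective) {s : Set A} {t : Set B} :
    ListMatching (ι '' s) (κ '' t) R ↔ ListMatching s t fun a b => R (ι a) (κ b) := by
  constructor
  · rintro h l ⟨hl, hls⟩
    obtain ⟨m, ⟨hm, hmt⟩, hR⟩ := h (l.map ι) ⟨hl.map hι, by simpa [hι.eq_iff] using hls⟩
    obtain ⟨m, rfl⟩ : m ∈ Set.range (List.map κ) := by
      rw [Set.range_list_map]
      exact fun b hb => Set.image_subset_range _ _ (hmt b hb)
    rw [List.forall₂_map_left_iff, List.forall₂_map_right_iff] at hR
    exact ⟨m, ⟨hm.of_map, by simpa [hκ.eq_iff] using hmt⟩, hR⟩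
  · rintro h l ⟨hl, hls⟩
    obtain ⟨l, rfl⟩ : l ∈ Set.range (List.map ι) := by
      rw [Set.range_list_map]
      exact fun a ha => Set.image_subset_range _ _ (hls a ha)
    obtain ⟨m, ⟨hm, hmt⟩, hR⟩ := h l ⟨hl.of_map, by simpa [hι.eq_iff] using hls⟩
    refine ⟨m.map κ, ⟨hm.map hκ, by simpa [hκ.eq_iff] using hmt⟩, ?_⟩
    rwa [List.forall₂_map_left_iff, List.forall₂_map_right_iff]

theorem exists_of_mem_right_of_forall₂ {l : List α} {m : List β} (h : List.Forall₂ R l m) {b : β}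
    (hb : b ∈ m) : ∃ a ∈ l, R a b := by
  induction h with
  | nil => simp at hb
  | cons hab _ ih =>
    rcases List.mem_cons.1 hb with rfl | hb
    · exact ⟨_, List.mem_cons_self, hab⟩
    · obtain ⟨a, ha, hR⟩ := ih hb
      exact ⟨a, List.mem_cons_of_mem _ ha, hR⟩

namespace ListMatching

theorem encard_fiber_le (h : ListMatching s t R) {γ : Type} {f : s → γ} {g : t → γ}
    (hfg : ∀ a b, R a.1 b.1 → g b = f a) (c : γ) : (f ⁻¹' {c}).encard ≤ (g ⁻¹' {c}).encard := by
  refine ENat.forall_natCast_le_iff_le.1 fun n hn => ?_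
  obtain ⟨l, ⟨hl, hlc⟩, rfl⟩ := natCast_le_encard_iff.1 hn
  obtain ⟨m, ⟨hm, hmt⟩, hR⟩ := h (l.map (↑)) ⟨hl.map Subtype.val_injective, by simp +contextual⟩
  lift m to List t using hmt
  rw [List.forall₂_map_left_iff, List.forall₂_map_right_iff] at hR
  refine natCast_le_encard_iff.2 ⟨m, ⟨hm.of_map, fun b hb => ?_⟩, hR.length_eq.symm⟩
  obtain ⟨a, ha, hab⟩ := exists_of_mem_right_of_forall₂ hR hb
  exact (hfg a b hab).trans (hlc a ha)

theorem exists_mem (h : ListMatching s t R) {a : α} (ha : a ∈ s) : ∃ b ∈ t, R a b := by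
  obtain ⟨m, ⟨-, hmt⟩, hR⟩ := h [a] (by simpa using ha)
  obtain ⟨b, m, hab, -, rfl⟩ := List.forall₂_cons_left_iff.1 hR
  exact ⟨b, hmt b List.mem_cons_self, hab⟩

theorem mono {R' : α → β → Prop}
    (h : ListMatching s t R) (hR : ∀ a ∈ s, ∀ b ∈ t, R a b → R' a b) : ListMatching s t R' := by
  intro l hl
  obtain ⟨m, hm, hlm⟩ := h l hl
  obtain ⟨hlen, hget⟩ := List.forall₂_iff_get.1 hlm
  exact ⟨m, hm, List.forall₂_iff_get.2 ⟨hlen, fun i hi hi' =>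
    hR _ (hl.2 _ (List.get_mem _ _)) _ (hm.2 _ (List.get_mem _ _)) (hget i hi hi')⟩⟩

end ListMatching

theorem listMatching_congr {R' : α → β → Prop}
    (hR : ∀ a ∈ s, ∀ b ∈ t, R a b ↔ R' a b) : ListMatching s t R ↔ ListMatching s t R' :=
  ⟨fun h => h.mono fun a ha b hb => (hR a ha b hb).1,
    fun h => h.mono fun a ha b hb => (hR a ha b hb).2⟩

theorem nonempty_equiv_of_encard_eq [Countable α] [Countable β] (h : s.encard = t.encard) :
    Nonempty (s ≃ t) :=
  Cardinal.eq.1 <| Cardinal.toENat_injOn (Cardinal.mk_le_aleph0 (α := s))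
    (Cardinal.mk_le_aleph0 (α := t)) h

theorem exists_equiv_of_encard_fiber_eq [Countable α] [Countable β] {γ : Type} (f : α → γ)
    (g : β → γ) (h : ∀ c, (f ⁻¹' {c}).encard = (g ⁻¹' {c}).encard) :
    ∃ e : α ≃ β, ∀ a, g (e a) = f a := by
  let e := fun c => (nonempty_equiv_of_encard_eq (h c)).some
  exact ⟨(Equiv.sigmaFiberEquiv f).symm.trans
    ((Equiv.sigmaCongrRight e).trans (Equiv.sigmaFiberEquiv g)), fun a => (e (f a) ⟨a, rfl⟩).2⟩

theorem ListMatching.exists_equiv [Countable α] [Countable β]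
    (hR : ∀ a b a' b', R a b → R a' b → R a' b' → R a b')
    (h : ListMatching s t R) (h' : ListMatching t s fun b a => R a b) :
    ∃ e : s ≃ t, ∀ a : s, R a (e a) := by
  -- Since `R` is difunctional, its classes colour `s` and `t`, and related elements are those of
  -- the same colour.
  let f : s → Set β := fun a => {b | b ∈ t ∧ R a b}
  let g : t → Set β := fun b => {b' | b' ∈ t ∧ ∃ a ∈ s, R a b ∧ R a b'}
  have related_iff (a : s) (b : t) : g b = f a ↔ R a b := by
    constructor
    · intro heq
      obtain ⟨a', ha', hab⟩ := h'.exists_mem b.2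
      exact (heq ▸ (⟨b.2, a', ha', hab, hab⟩ : b.1 ∈ g b) : b.1 ∈ f a).2
    · intro hab
      ext b'
      exact and_congr_right fun _ => ⟨fun ⟨a', _, hb, hb'⟩ => hR _ _ _ _ hab hb hb',
        fun hb' => ⟨a, a.2, hab, hb'⟩⟩
  obtain ⟨e, he⟩ := exists_equiv_of_encard_fiber_eq f g fun c => le_antisymm
    (h.encard_fiber_le (fun a b => (related_iff a b).2) c)
    (h'.encard_fiber_le (fun b a hab => ((related_iff a b).2 hab).symm) c)
  exact ⟨e, fun a => (related_iff a (e a)).1 (he a)⟩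

theorem exists_equiv_iff_listMatching [Countable α] [Countable β]
    (hR : ∀ a b a' b', R a b → R a' b → R a' b' → R a b') :
    (∃ e : s ≃ t, ∀ a : s, R a (e a)) ↔
      ListMatching s t R ∧ ListMatching t s fun b a => R a b := by
  refine ⟨fun ⟨e, he⟩ => ⟨listMatching_of_equiv e he, listMatching_of_equiv e.symm fun b => ?_⟩,
    fun h => h.1.exists_equiv hR h.2⟩
  simpa using he (e.symm b)

end Matching

/-! ## Cones in trees -/

section Cones

theorem nonempty_withBot_sigma_orderIso {ι κ : Type} {S : ι → Type} {T : κ → Type}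
    [∀ i, PartialOrder (S i)] [∀ j, PartialOrder (T j)] (e : ι ≃ κ)
    (h : ∀ i, Nonempty (S i ≃o T (e i))) :
    Nonempty (WithBot (Σ i, S i) ≃o WithBot (Σ j, T j)) := by
  let φ := fun i => (h i).some
  refine ⟨OrderIso.withBotCongr ⟨Equiv.sigmaCongr e fun i => (φ i).toEquiv, ?_⟩⟩
  rintro ⟨i, a⟩ ⟨j, b⟩
  by_cases hij : i = j
  · subst hij
    exact Sigma.mk_le_mk_iff.trans ((φ i).le_iff_le.trans Sigma.mk_le_mk_iff.symm)
  · refine iff_of_false (fun h => hij (e.injective ?_)) fun h => hij ?_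
    · exact (Sigma.le_def.1 h).1
    · exact (Sigma.le_def.1 h).1

variable {V W : Type} [PartialOrder V] [PartialOrder W]

theorem covBy_unique_of_isChain (hV : ∀ x : V, IsChain (· ≤ ·) (Set.Iic x)) {x y z w : V}
    (hy : x ⋖ y) (hz : x ⋖ z) (hyw : y ≤ w) (hzw : z ≤ w) : y = z := by
  rcases (hV w).total hyw hzw with h | h
  · exact (hz.eq_or_eq hy.le h).resolve_left hy.lt.ne'
  · exact ((hy.eq_or_eq hz.le h).resolve_left hz.lt.ne').symm

theorem nonempty_ici_orderIso_withBot_sigma [IsStronglyAtomic V]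
    (hV : ∀ x : V, IsChain (· ≤ ·) (Set.Iic x)) (x : V) :
    Nonempty (WithBot (Σ z : {z | x ⋖ z}, Set.Ici z.1) ≃o Set.Ici x) := by
  let f : WithBot (Σ z : {z | x ⋖ z}, Set.Ici z.1) → Set.Ici x :=
    WithBot.recBotCoe ⟨x, le_rfl⟩ fun a => ⟨a.2, a.1.2.le.trans a.2.2⟩
  have f_le_iff (a b) : f a ≤ f b ↔ a ≤ b := by
    cases a using WithBot.recBotCoe with
    | bot => exact iff_of_true (f b).2 bot_le
    | coe a =>
      have hxa : x < a.2.1 := a.1.2.lt.trans_le a.2.2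
      cases b using WithBot.recBotCoe with
      | bot => exact iff_of_false hxa.not_ge (WithBot.not_coe_le_bot a)
      | coe b =>
        obtain ⟨z, a⟩ := a
        obtain ⟨w, b⟩ := b
        rw [WithBot.coe_le_coe]
        refine ⟨fun hab => ?_, ?_⟩
        · obtain rfl : z = w := Subtype.ext
            (covBy_unique_of_isChain hV z.2 w.2 (a.2.trans hab) b.2)
          exact Sigma.mk_le_mk_iff.2 hab
        · rintro ⟨_, _, _, hab⟩
          exact hab
  have f_surjective : f.Surjective := by
    rintro ⟨w, hw⟩
    rcases eq_or_lt_of_le hw with rfl | hw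
    · exact ⟨⊥, rfl⟩
    · obtain ⟨z, hz, hzw⟩ := exists_covBy_le_of_lt hw
      exact ⟨WithBot.some ⟨⟨z, hz⟩, w, hzw⟩, rfl⟩
  exact ⟨RelIso.ofSurjective (OrderEmbedding.ofMapLEIff f f_le_iff) f_surjective⟩

theorem nonempty_ici_orderIso_apply {x : V} {y : W} (e : Set.Ici x ≃o Set.Ici y) (a : Set.Ici x) :
    Nonempty (Set.Ici a.1 ≃o Set.Ici (e a).1) :=
  ⟨{toFun b := ⟨e ⟨b, a.2.trans b.2⟩, e.monotone (a := a) b.2⟩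
    invFun c := ⟨e.symm ⟨c, (e a).2.trans c.2⟩, e.le_symm_apply.2 c.2⟩
    left_inv b := Subtype.ext (congrArg Subtype.val (e.symm_apply_apply ⟨b, a.2.trans b.2⟩) :)
    right_inv c := Subtype.ext (congrArg Subtype.val (e.apply_symm_apply ⟨c, (e a).2.trans c.2⟩) :)
    map_rel_iff' := e.le_iff_le}⟩

theorem covBy_apply_iff_of_ici_orderIso {x : V} {y : W} (e : Set.Ici x ≃o Set.Ici y)
    (a : Set.Ici x) : y ⋖ (e a).1 ↔ x ⋖ a.1 := by
  have covBy_coe_iff {U : Type} [PartialOrder U] {u : U} (b : Set.Ici u) : u ⋖ b.1 ↔ ⊥ ⋖ b :=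
    Set.OrdConnected.apply_covBy_apply_iff (a := (⊥ : Set.Ici u)) (b := b)
      (OrderEmbedding.subtype fun v : U => u ≤ v)
      (Subtype.range_coe.symm ▸ Set.ordConnected_Ici (a := u))
  rw [covBy_coe_iff, covBy_coe_iff, ← apply_covBy_apply_iff e, e.map_bot]

theorem exists_covBy_equiv_of_ici_orderIso {x : V} {y : W} (e : Set.Ici x ≃o Set.Ici y) :
    ∃ f : {z | x ⋖ z} ≃ {w | y ⋖ w}, ∀ z, Nonempty (Set.Ici z.1 ≃o Set.Ici (f z).1) := by
  refine ⟨{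
    toFun z := ⟨e ⟨z, z.2.le⟩, (covBy_apply_iff_of_ici_orderIso e _).2 z.2⟩
    invFun w := ⟨e.symm ⟨w, w.2.le⟩, (covBy_apply_iff_of_ici_orderIso e.symm _).2 w.2⟩
    left_inv z := Subtype.ext (congrArg Subtype.val (e.symm_apply_apply ⟨z, z.2.le⟩) :)
    right_inv w := Subtype.ext (congrArg Subtype.val (e.apply_symm_apply ⟨w, w.2.le⟩) :) },
    fun z => nonempty_ici_orderIso_apply e ⟨z, z.2.le⟩⟩

theorem nonempty_ici_orderIso_iff [IsStronglyAtomic V] [IsStronglyAtomic W]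
    (hV : ∀ x : V, IsChain (· ≤ ·) (Set.Iic x)) (hW : ∀ y : W, IsChain (· ≤ ·) (Set.Iic y))
    {x : V} {y : W} :
    Nonempty (Set.Ici x ≃o Set.Ici y) ↔
      ∃ f : {z | x ⋖ z} ≃ {w | y ⋖ w}, ∀ z, Nonempty (Set.Ici z.1 ≃o Set.Ici (f z).1) := by
  refine ⟨fun ⟨e⟩ => exists_covBy_equiv_of_ici_orderIso e, fun ⟨f, hf⟩ => ?_⟩
  obtain ⟨φ⟩ := nonempty_ici_orderIso_withBot_sigma hV x
  obtain ⟨ψ⟩ := nonempty_ici_orderIso_withBot_sigma hW y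
  obtain ⟨χ⟩ := nonempty_withBot_sigma_orderIso (S := fun z : {z | x ⋖ z} => Set.Ici z.1)
    (T := fun w : {w | y ⋖ w} => Set.Ici w.1) f hf
  exact ⟨(φ.symm.trans χ).trans ψ⟩

theorem nonempty_ici_orderIso_iff_listMatching [Countable V] [Countable W] [IsStronglyAtomic V]
    [IsStronglyAtomic W] (hV : ∀ x : V, IsChain (· ≤ ·) (Set.Iic x))
    (hW : ∀ y : W, IsChain (· ≤ ·) (Set.Iic y)) {x : V} {y : W} :
    Nonempty (Set.Ici x ≃o Set.Ici y) ↔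
      ListMatching {z | x ⋖ z} {w | y ⋖ w} (fun z w => Nonempty (Set.Ici z ≃o Set.Ici w)) ∧
      ListMatching {w | y ⋖ w} {z | x ⋖ z} (fun w z => Nonempty (Set.Ici z ≃o Set.Ici w)) := by
  rw [nonempty_ici_orderIso_iff hV hW, ← exists_equiv_iff_listMatching]
  rintro z w z' w' ⟨e₁⟩ ⟨e₂⟩ ⟨e₃⟩
  exact ⟨(e₁.trans e₂.symm).trans e₃⟩

end Cones

/-! ## Presentations of trees -/

section Trees

theorem natCast_length_le_encard_iio_last {V : Type} [Preorder V] (p : LTSeries V) :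
    p.length ≤ (Set.Iio p.last).encard := by
  have himage : p '' Set.Iio (Fin.last _) ⊆ Set.Iio p.last := by
    rintro _ ⟨i, hi, rfl⟩
    exact p.strictMono hi
  refine le_of_eq_of_le ?_ (Set.encard_le_encard himage)
  rw [p.strictMono.injective.encard_image, Set.encard_eq_coe_toFinset_card]
  simp

theorem nonempty_orderIso_iff_ici {V W : Type} [PartialOrder V] [PartialOrder W] {r : V} {s : W}
    (hr : IsBot r) (hs : IsBot s) :
    Nonempty (V ≃o W) ↔ Nonempty (Set.Ici r ≃o Set.Ici s) := by
  rw [hr.Ici_eq, hs.Ici_eq]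
  exact ⟨fun ⟨e⟩ => ⟨(OrderIso.Set.univ.trans e).trans OrderIso.Set.univ.symm⟩,
    fun ⟨e⟩ => ⟨(OrderIso.Set.univ.symm.trans e).trans OrderIso.Set.univ⟩⟩

theorem IsTree.isChain_Iic {V : Type} [Preorder V] (hV : IsTree (V := V) (· ≤ ·)) (x : V) :
    IsChain (· ≤ ·) (Set.Iic x) :=
  fun _ hy _ hz _ => hV.linear_ancestors _ _ _ hy hz

theorem IsTree.isStronglyAtomic {V : Type} [PartialOrder V] (hV : IsTree (V := V) (· ≤ ·)) :
    IsStronglyAtomic V :=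
  letI := LocallyFiniteOrder.ofFiniteIcc fun _ b : V =>
    (hV.finite_ancestors b).subset fun _ hx => hx.2
  inferInstance

theorem IsTree.exists_isBot {V : Type} [Preorder V] (hV : IsTree (V := V) (· ≤ ·)) :
    ∃ r : V, IsBot r :=
  hV.exists_root

theorem coheight_le_of_height_le {V : Type} [PartialOrder V] {n : ℕ}
    (hn : height (V := V) (· ≤ ·) ≤ n) (x : V) : Order.coheight x ≤ n := by
  rw [Order.coheight_le_iff]
  intro p _
  refine (natCast_length_le_encard_iio_last p).trans (le_trans ?_ hn)
  refine le_trans (Set.encard_le_encard ?_) (le_iSup (level (V := V) (· ≤ ·)) p.last)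
  exact fun y hy => ⟨hy.le, hy.ne⟩

theorem covBy_of_coheight_le_one {V : Type} [Preorder V] {a b : V} (ha : Order.coheight a ≤ 1)
    (hab : a < b) : a ⋖ b := by
  refine ⟨hab, fun c hac hcb => ?_⟩
  have hc : Order.coheight c < 1 := Order.coheight_le_coe_iff.1 (mod_cast ha) c hac
  exact (Order.coheight_eq_zero.1 (Order.lt_one_iff.1 hc)).not_lt hcb

/-- The partial order of a tree. -/
@[reducible]
def IsTree.partialOrder {V : Type} {le : V → V → Prop} (h : IsTree le) : PartialOrder V where
  le := le
  le_refl := h.refl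
  le_trans := h.trans
  le_antisymm := h.antisymm

theorem isTree_and_height_le_iff {V : Type} {le : V → V → Prop} {n : ℕ} :
    IsTree le ∧ height le ≤ n ↔ Nonempty V ∧ ∀ x y z, le x x ∧ (le x y ∧ le y x → x = y) ∧
      (le x y ∧ le y z → le x z) ∧ (∃ w, le w x ∧ le w y) ∧
      (le y x ∧ le z x → le y z ∨ le z y) ∧ level le x ≤ n := by
  constructor
  · rintro ⟨hV, hn⟩
    obtain ⟨r, hr⟩ := hV.exists_root
    exact ⟨⟨r⟩, fun x y z => ⟨hV.refl x, fun h => hV.antisymm x y h.1 h.2,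
      fun h => hV.trans x y z h.1 h.2, ⟨r, hr x, hr y⟩,
      fun h => hV.linear_ancestors x y z h.1 h.2, (le_iSup _ x).trans hn⟩⟩
  · rintro ⟨hne, h⟩
    obtain ⟨x₀⟩ := id hne
    simp only [forall_and, forall_const] at h
    obtain ⟨hrefl, hantisymm, htrans, hdirected, hlinear, hlevel⟩ := h
    have finite_ancestors (x : V) : {y | le y x}.Finite := by
      refine ((Set.finite_of_encard_le_coe (hlevel x)).insert x).subset fun y hy => ?_
      exact or_iff_not_imp_left.2 fun hyx => ⟨hy, hyx⟩
    let _ : PartialOrder V :=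
      { le, le_refl := hrefl, le_trans x y z hxy hyz := htrans x y z ⟨hxy, hyz⟩,
        le_antisymm x y hxy hyx := hantisymm x y ⟨hxy, hyx⟩ }
    obtain ⟨m, hm, hmin⟩ := (finite_ancestors x₀).exists_minimal ⟨x₀, hrefl x₀⟩
    refine ⟨⟨hrefl, fun x y hxy hyx => hantisymm x y ⟨hxy, hyx⟩,
      fun x y z hxy hyz => htrans x y z ⟨hxy, hyz⟩, ⟨m, fun x => ?_⟩, finite_ancestors,
      fun x y z hy hz => hlinear x y z ⟨hy, hz⟩⟩, iSup_le hlevel⟩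
    obtain ⟨w, hwm, hwx⟩ := hdirected m x
    have hmw : le m w := hmin (htrans w m x₀ ⟨hwm, hm⟩) hwm
    exact htrans m w x ⟨hmw, hwx⟩

end Trees

section Presentations

/-- The binary relation on natural numbers accepted by the second program of a presentation. -/
def Presentation.natRel (P : Presentation) (x y : ℕ) : Prop := Accepts P.2 (Nat.pair x y)

/-- `P` presents the structure `(V; r)`, with `ι a` as the name of the element `a`. -/
structure Presents (P : Presentation) {V : Type} (r : V → V → Prop) (ι : V → ℕ) : Prop where
  injective : ι.Injective
  accepts_iff : ∀ x, Accepts P.1 x ↔ ∃ a, ι a = x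
  natRel_iff : ∀ x y, P.natRel x y ↔ ∃ a b, r a b ∧ ι a = x ∧ ι b = y

theorem Presentation.IsValid.presents {P : Presentation} (hP : P.IsValid) :
    Presents P P.rel Subtype.val where
  injective := Subtype.val_injective
  accepts_iff x := ⟨fun h => ⟨⟨x, h⟩, rfl⟩, fun ⟨a, ha⟩ => ha ▸ a.2⟩
  natRel_iff x y := by
    constructor
    · exact fun h => ⟨⟨x, (hP.rel_subset x y h).1⟩, ⟨y, (hP.rel_subset x y h).2⟩, h, rfl, rfl⟩
    · rintro ⟨a, b, h, rfl, rfl⟩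
      exact h

namespace Presents

variable {P : Presentation} {V : Type} {r : V → V → Prop} {ι : V → ℕ}

theorem natRel_apply_iff (h : Presents P r ι) {a b : V} : P.natRel (ι a) (ι b) ↔ r a b := by
  simp [h.natRel_iff, h.injective.eq_iff]

theorem nonempty_relIso (h : Presents P r ι) : Nonempty (P.rel ≃r r) := by
  let f (a : V) : P.Dom := ⟨ι a, (h.accepts_iff _).2 ⟨a, rfl⟩⟩
  have f_bijective : f.Bijective :=
    ⟨fun a b hab => h.injective (congrArg Subtype.val hab), fun x =>
      ((h.accepts_iff x.1).1 x.2).imp fun a ha => Subtype.ext ha⟩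
  exact ⟨RelIso.symm ⟨Equiv.ofBijective f f_bijective, h.natRel_apply_iff⟩⟩

end Presents

end Presentations

/-! ## The isomorphism problem is in `Π⁰_{2n}` -/

section UpperBound

/-- `z` is a child of the node `u.2` of the tree presented by `u.1`. For `k = 0`, when only nodes
without grandchildren are considered, it is enough that `z` lies above `u.2`. This keeps the
relation in `Σ⁰_{2k+1}`: being an immediate successor is not `Σ⁰_1`. -/
def ChildOf (k : ℕ) (u : Presentation × ℕ) (z : ℕ) : Prop :=
  u.1.natRel u.2 z ∧ u.2 ≠ z ∧
    (k ≠ 0 → ∀ w, u.1.natRel u.2 w ∧ u.1.natRel w z → w = u.2 ∨ w = z)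

/-- An arithmetical description of the isomorphism of the cones above the nodes `u.2` and `v.2` of
the trees presented by `u.1` and `v.1`, when these cones have height at most `k`. -/
def ConeMatching : ℕ → Presentation × ℕ → Presentation × ℕ → Prop
  | 0, _, _ => True
  | k + 1, u, v =>
    ListMatching {z | ChildOf k u z} {w | ChildOf k v w}
      (fun z w => ConeMatching k (u.1, z) (v.1, w)) ∧
    ListMatching {w | ChildOf k v w} {z | ChildOf k u z}
      (fun w z => ConeMatching k (u.1, z) (v.1, w))

variable {P Q : Presentation} {V W : Type} {ι : V → ℕ} {κ : W → ℕ}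

theorem childOf_apply_iff [PartialOrder V] (hP : Presents P (V := V) (· ≤ ·) ι) {k : ℕ} {a b : V}
    (ha : Order.coheight a ≤ k + 1) : ChildOf k (P, ι a) (ι b) ↔ a ⋖ b := by
  simp only [ChildOf, hP.natRel_apply_iff, hP.injective.ne_iff]
  rw [← and_assoc, ← lt_iff_le_and_ne]
  rcases eq_or_ne k 0 with rfl | hk
  · simpa using ⟨covBy_of_coheight_le_one (by simpa using ha), CovBy.lt⟩
  · rw [covBy_iff_lt_and_eq_or_eq]
    refine and_congr_right fun _ => ⟨fun h c hac hcb => ?_, fun h _ w hw => ?_⟩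
    · simpa [hP.natRel_apply_iff, hP.injective.eq_iff, hac, hcb] using h hk (ι c)
    · obtain ⟨c, -, -, rfl, -⟩ := (hP.natRel_iff _ _).1 hw.2
      simp only [hP.natRel_apply_iff] at hw
      simpa only [hP.injective.eq_iff] using h c hw.1 hw.2

theorem setOf_childOf [PartialOrder V] (hP : Presents P (V := V) (· ≤ ·) ι) {k : ℕ} {a : V}
    (ha : Order.coheight a ≤ k + 1) : {z | ChildOf k (P, ι a) z} = ι '' {b | a ⋖ b} := by
  ext z
  constructor
  · intro hz
    obtain ⟨_, b, _, _, rfl⟩ := (hP.natRel_iff _ _).1 hz.1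
    exact ⟨b, (childOf_apply_iff hP ha).1 hz, rfl⟩
  · rintro ⟨b, hb, rfl⟩
    exact (childOf_apply_iff hP ha).2 hb

theorem coneMatching_iff [PartialOrder V] [PartialOrder W] (hP : Presents P (V := V) (· ≤ ·) ι)
    (hQ : Presents Q (V := W) (· ≤ ·) κ) (hV : IsTree (V := V) (· ≤ ·))
    (hW : IsTree (V := W) (· ≤ ·)) {k : ℕ} {a : V} {b : W} (ha : Order.coheight a ≤ k)
    (hb : Order.coheight b ≤ k) :
    ConeMatching k (P, ι a) (Q, κ b) ↔ Nonempty (Set.Ici a ≃o Set.Ici b) := by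
  have := hP.injective.countable
  have := hQ.injective.countable
  have := hV.isStronglyAtomic
  have := hW.isStronglyAtomic
  induction k generalizing a b with
  | zero =>
    have ha : IsMax a := by simpa using ha
    have hb : IsMax b := by simpa using hb
    rw [ha.Ici_eq, hb.Ici_eq]
    exact iff_of_true trivial ⟨OrderIso.ofUnique _ _⟩
  | succ k ih =>
    have coheight_le {U : Type} [PartialOrder U] {u v : U} (hu : Order.coheight u ≤ (k + 1 : ℕ))
        (huv : u ⋖ v) : Order.coheight v ≤ k := by
      simpa using (Order.coheight_add_one_le huv.lt).trans hu
    rw [nonempty_ici_orderIso_iff_listMatching hV.isChain_Iic hW.isChain_Iic, ConeMatching,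
      setOf_childOf hP (mod_cast ha), setOf_childOf hQ (mod_cast hb),
      listMatching_image_iff hP.injective hQ.injective,
      listMatching_image_iff hQ.injective hP.injective]
    exact and_congr
      (listMatching_congr fun _ h _ h' => ih (coheight_le ha h) (coheight_le hb h'))
      (listMatching_congr fun _ h _ h' => ih (coheight_le ha h') (coheight_le hb h))

/-- `r` is a minimal node of the structure presented by `P`. Compared with being a least node,
this has a lower complexity. -/
def IsMinimalNode (P : Presentation) (r : ℕ) : Prop :=
  Accepts P.1 r ∧ ∀ x, P.natRel x r → x = r

theorem isMinimalNode_iff [PartialOrder V] (hP : Presents P (V := V) (· ≤ ·) ι) {r : V}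
    (hr : IsBot r) {x : ℕ} : IsMinimalNode P x ↔ x = ι r := by
  constructor
  · rintro ⟨hx, hmin⟩
    obtain ⟨a, rfl⟩ := (hP.accepts_iff _).1 hx
    exact (hmin _ (hP.natRel_apply_iff.2 (hr a))).symm
  · rintro rfl
    refine ⟨(hP.accepts_iff _).2 ⟨r, rfl⟩, fun x hx => ?_⟩
    obtain ⟨a, _, har, rfl, h⟩ := (hP.natRel_iff _ _).1 hx
    rw [(hr a).antisymm (har.trans_eq (hP.injective h))]

theorem iso_iff_coneMatching {n : ℕ} (hP : P.IsTreeOfHeightLE n) (hQ : Q.IsTreeOfHeightLE n) :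
    P.Iso Q ↔ ∀ r s, IsMinimalNode P r ∧ IsMinimalNode Q s → ConeMatching n (P, r) (Q, s) := by
  obtain ⟨hPvalid, hPtree, hPn⟩ := hP
  obtain ⟨hQvalid, hQtree, hQn⟩ := hQ
  let _ := hPtree.partialOrder
  let _ := hQtree.partialOrder
  obtain ⟨r, hr⟩ := hPtree.exists_isBot
  obtain ⟨s, hs⟩ := hQtree.exists_isBot
  simp only [isMinimalNode_iff hPvalid.presents hr, isMinimalNode_iff hQvalid.presents hs]
  refine (nonempty_orderIso_iff_ici hr hs).trans ?_
  rw [← coneMatching_iff hPvalid.presents hQvalid.presents hPtree hQtree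
    (coheight_le_of_height_le hPn r) (coheight_le_of_height_le hQn s)]
  simp

end UpperBound

section Complexity

variable {α : Type} [Primcodable α] {k : ℕ} {p : α → ℕ → Prop}

theorem IsSigma0.forall_mem (hp : IsSigma0 k fun x : α × ℕ => p x.1 x.2) {l : α → List ℕ}
    (hl : Computable l) : IsSigma0 k fun a => ∀ b ∈ l a, p a b := by
  refine (IsSigma0.forall_lt (p := fun a i => p a ((l a).getD i 0))
    (hp.comp (f := fun x : α × ℕ => (x.1, (l x.1).getD x.2 0)) (by fun_prop))
    (computable_length hl)).of_iff fun a => ?_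
  rw [List.forall_mem_iff_getElem]
  exact forall₂_congr fun i hi => by rw [List.getD_eq_getElem _ _ hi]

theorem IsSigma0.forall₂ {r : α → ℕ → ℕ → Prop}
    (hr : IsSigma0 k fun x : α × ℕ × ℕ => r x.1 x.2.1 x.2.2) {l m : α → List ℕ}
    (hl : Computable l) (hm : Computable m) :
    IsSigma0 k fun a => List.Forall₂ (r a) (l a) (m a) := by
  refine ((isDelta0_eq (computable_length hl) (computable_length hm) k).1.and
    (IsSigma0.forall_lt (p := fun a i => r a ((l a).getD i 0) ((m a).getD i 0))
      (hr.comp (f := fun x : α × ℕ => (x.1, (l x.1).getD x.2 0, (m x.1).getD x.2 0))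
        (by fun_prop)) (computable_length hl))).of_iff fun a => ?_
  rw [List.forall₂_iff_get]
  refine and_congr_right fun hlen => ⟨fun h i hi => ?_, fun h i hi hi' => ?_⟩
  · rw [List.getD_eq_getElem _ _ hi, List.getD_eq_getElem _ _ (hlen ▸ hi)]
    exact h i hi (hlen ▸ hi)
  · simpa only [List.getD_eq_getElem _ _ hi, List.getD_eq_getElem _ _ hi'] using! h i hi

theorem computablePred_nodup {l : α → List ℕ} (hl : Computable l) :
    ComputablePred fun a => (l a).Nodup := by
  have hne : ComputablePred fun x : (α × ℕ) × ℕ =>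
      (l x.1.1).getD x.2 0 ≠ (l x.1.1).getD x.1.2 0 :=
    (computablePred_eq (by fun_prop) (by fun_prop)).not
  refine (computablePred_forall_lt
    (p := fun a j => ∀ i < j, (l a).getD i 0 ≠ (l a).getD j 0)
    (computablePred_forall_lt hne Computable.snd) (computable_length hl)).of_eq fun a => ?_
  rw [List.Nodup, List.pairwise_iff_getElem]
  refine ⟨fun h i j hi hj hij => ?_, fun h j hj i hij => ?_⟩
  · simpa [hi, hj] using h j hj i hij
  · simpa [hj, hij.trans hj] using h i j (hij.trans hj) hj hij

theorem IsSigma0.nodup_and_forall_mem (hp : IsSigma0 k fun x : α × ℕ => p x.1 x.2)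
    {l : α → List ℕ} (hl : Computable l) :
    IsSigma0 k fun a => (l a).Nodup ∧ ∀ b ∈ l a, p a b :=
  (isDelta0_of_computablePred (computablePred_nodup hl) k).1.and (hp.forall_mem hl)

theorem isPi0_encard_le (hp : IsSigma0 (k + 1) fun x : α × ℕ => p x.1 x.2) (n : ℕ) :
    IsPi0 (k + 1) fun a => {y | p a y}.encard ≤ n := by
  simp only [encard_le_natCast_iff, Set.mem_ofPred_eq]
  refine IsPi0.forall (IsPi0.imp ?_ ?_)
  · exact IsSigma0.nodup_and_forall_mem (p := fun (x : α × List ℕ) b => p x.1 b)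
      (hp.comp (f := fun x : (α × List ℕ) × ℕ => (x.1.1, x.2)) (by fun_prop)) Computable.snd
  · refine (isDelta0_of_computablePred ((computablePred_lt (f := fun _ => n)
      (g := fun x : α × List ℕ => x.2.length) (by fun_prop) (by fun_prop)).not.of_eq ?_) _).2
    simp

theorem isPi0_listMatching {q : α → ℕ → Prop} {r : α → ℕ → ℕ → Prop}
    (hp : IsSigma0 (k + 1) fun x : α × ℕ => p x.1 x.2)
    (hq : IsSigma0 (k + 1) fun x : α × ℕ => q x.1 x.2)
    (hr : IsSigma0 (k + 1) fun x : α × ℕ × ℕ => r x.1 x.2.1 x.2.2) :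
    IsPi0 (k + 2) fun a => ListMatching {y | p a y} {z | q a z} (r a) := by
  refine IsPi0.forall (IsPi0.imp ?_ (IsSigma0.isDelta0 ?_ (Nat.lt_succ_self _)).2)
  · exact (IsSigma0.nodup_and_forall_mem (p := fun (x : α × List ℕ) b => p x.1 b)
      (hp.comp (f := fun x : (α × List ℕ) × ℕ => (x.1.1, x.2)) (by fun_prop))
      Computable.snd).succ
  · refine IsSigma0.exists (IsSigma0.and ?_ ?_)
    · exact IsSigma0.nodup_and_forall_mem (p := fun (x : (α × List ℕ) × List ℕ) c => q x.1.1 c)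
        (hq.comp (f := fun x : ((α × List ℕ) × List ℕ) × ℕ => (x.1.1.1, x.2)) (by fun_prop))
        Computable.snd
    · exact IsSigma0.forall₂ (r := fun (x : (α × List ℕ) × List ℕ) => r x.1.1)
        (hr.comp (f := fun x : ((α × List ℕ) × List ℕ) × ℕ × ℕ => (x.1.1.1, x.2)) (by fun_prop))
        (by fun_prop) (by fun_prop)

theorem isSigma0_eval_eq {c : α → Code} {x : α → ℕ} (hc : Computable c) (hx : Computable x)
    (m : ℕ) : IsSigma0 1 fun a => (c a).eval (x a) = Part.some m := by
  have halts_within : ComputablePred fun y : α × ℕ => Code.evaln y.2 (c y.1) (x y.1) = some m :=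
    computablePred_eq (Code.primrec_evaln.to_comp.comp
      (g := fun y : α × ℕ => ((y.2, c y.1), x y.1)) (by fun_prop)) (Computable.const _)
  refine (IsSigma0.exists_nat (p := fun a s => Code.evaln s (c a) (x a) = some m)
    (isDelta0_of_computablePred halts_within 1).1).of_iff fun a => ?_
  rw [Part.eq_some_iff, Code.evaln_complete]
  rfl

theorem isSigma0_accepts {c : α → Code} {x : α → ℕ} (hc : Computable c) (hx : Computable x) :
    IsSigma0 1 fun a => Accepts (c a) (x a) :=
  isSigma0_eval_eq hc hx 1

theorem isSigma0_natRel {P : α → Presentation} {x y : α → ℕ} (hP : Computable P)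
    (hx : Computable x) (hy : Computable y) :
    IsSigma0 1 fun a => (P a).natRel (x a) (y a) :=
  isSigma0_accepts (c := fun a => (P a).2) (by fun_prop) (by fun_prop)

theorem isPi0_isDecider {c : α → Code} (hc : Computable c) :
    IsPi0 2 fun a => IsDecider (c a) := by
  refine IsPi0.forall (IsSigma0.isDelta0 ?_ one_lt_two).2
  exact (isSigma0_eval_eq (by fun_prop) (by fun_prop) 1).or
    (isSigma0_eval_eq (by fun_prop) (by fun_prop) 0)

theorem isPi0_isValid : IsPi0 2 Presentation.IsValid := by
  have rel_subset : IsPi0 2 fun P : Presentation => ∀ a b,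
      Accepts P.2 (Nat.pair a b) → Accepts P.1 a ∧ Accepts P.1 b := by
    refine IsPi0.forall (IsPi0.forall (IsPi0.imp (IsSigma0.succ ?_)
      (IsSigma0.isDelta0 (IsSigma0.and ?_ ?_) one_lt_two).2)) <;>
    exact isSigma0_accepts (by fun_prop) (by fun_prop)
  exact ((isPi0_isDecider Computable.fst).and
    ((isPi0_isDecider Computable.snd).and rel_subset)).of_iff
      fun P => ⟨fun h => ⟨h.1, h.2, h.3⟩, fun h => ⟨h.1, h.2.1, h.2.2⟩⟩

theorem isPi0_forall_dom {q : Presentation → ℕ → ℕ → ℕ → Prop}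
    (hq : IsPi0 2 fun u : Presentation × ℕ × ℕ × ℕ => q u.1 u.2.1 u.2.2.1 u.2.2.2) :
    IsPi0 2 fun P => ∀ x y z : P.Dom, q P x.1 y.1 z.1 := by
  have hdom : IsSigma0 1 fun u : Presentation × ℕ × ℕ × ℕ =>
      Accepts u.1.1 u.2.1 ∧ Accepts u.1.1 u.2.2.1 ∧ Accepts u.1.1 u.2.2.2 := by
    refine .and ?_ (.and ?_ ?_) <;> exact isSigma0_accepts (by fun_prop) (by fun_prop)
  refine (IsPi0.forall (p := fun (P : Presentation) (u : ℕ × ℕ × ℕ) =>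
    Accepts P.1 u.1 ∧ Accepts P.1 u.2.1 ∧ Accepts P.1 u.2.2 → q P u.1 u.2.1 u.2.2)
    (IsPi0.imp hdom.succ hq)).of_iff fun P => ?_
  exact ⟨fun h u hu => h ⟨_, hu.1⟩ ⟨_, hu.2.1⟩ ⟨_, hu.2.2⟩,
    fun h x y z => h (x.1, y.1, z.1) ⟨x.2, y.2, z.2⟩⟩

theorem Presentation.level_rel {P : Presentation} (x : P.Dom) :
    level P.rel x = {y | Accepts P.1 y ∧ P.natRel y x.1 ∧ y ≠ x.1}.encard := by
  refine (Subtype.val_injective.encard_image _).symm.trans (congrArg Set.encard ?_)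
  ext y
  constructor
  · rintro ⟨a, ⟨ha, hax⟩, rfl⟩
    exact ⟨a.2, ha, Subtype.coe_ne_coe.2 hax⟩
  · rintro ⟨hy, hyx, hne⟩
    exact ⟨⟨y, hy⟩, ⟨hyx, fun h => hne (congrArg Subtype.val h)⟩, rfl⟩

theorem isPi0_level_le (n : ℕ) :
    IsPi0 1 fun u : Presentation × ℕ =>
      {y | Accepts u.1.1 y ∧ u.1.natRel y u.2 ∧ y ≠ u.2}.encard ≤ n := by
  refine isPi0_encard_le (IsSigma0.and ?_ (IsSigma0.and ?_ (IsDelta0.not ?_).1)) n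
  · exact isSigma0_accepts (by fun_prop) (by fun_prop)
  · exact isSigma0_natRel (by fun_prop) (by fun_prop) (by fun_prop)
  · exact isDelta0_eq (by fun_prop) (by fun_prop) 1

theorem isPi0_isTree_and_height_le (n : ℕ) :
    IsPi0 2 fun P : Presentation => IsTree P.rel ∧ height P.rel ≤ n := by
  have rel {f g : Presentation × ℕ × ℕ × ℕ → ℕ} (hf : Computable f) (hg : Computable g) :
      IsDelta0 2 fun u : Presentation × ℕ × ℕ × ℕ => u.1.natRel (f u) (g u) :=
    (isSigma0_natRel Computable.fst hf hg).isDelta0 one_lt_two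
  have nonempty : IsDelta0 2 fun P : Presentation => ∃ x, Accepts P.1 x :=
    (IsSigma0.exists_nat (p := fun (P : Presentation) x => Accepts P.1 x)
      (isSigma0_accepts (by fun_prop) (by fun_prop))).isDelta0 one_lt_two
  refine (nonempty.2.and (isPi0_forall_dom (q := fun P x y z => P.natRel x x ∧
    (P.natRel x y ∧ P.natRel y x → x = y) ∧ (P.natRel x y ∧ P.natRel y z → P.natRel x z) ∧
    (∃ w, Accepts P.1 w ∧ P.natRel w x ∧ P.natRel w y) ∧
    (P.natRel y x ∧ P.natRel z x → P.natRel y z ∨ P.natRel z y) ∧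
    {y | Accepts P.1 y ∧ P.natRel y x ∧ y ≠ x}.encard ≤ n) ?_)).of_iff fun P => ?_
  · have lower_bound : IsDelta0 2 fun u : Presentation × ℕ × ℕ × ℕ =>
        ∃ w, Accepts u.1.1 w ∧ u.1.natRel w u.2.1 ∧ u.1.natRel w u.2.2.1 := by
      refine (IsSigma0.exists_nat (IsSigma0.and ?_ (IsSigma0.and ?_ ?_))).isDelta0 one_lt_two
      · exact isSigma0_accepts (by fun_prop) (by fun_prop)
      · exact isSigma0_natRel (by fun_prop) (by fun_prop) (by fun_prop)
      · exact isSigma0_natRel (by fun_prop) (by fun_prop) (by fun_prop)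
    have level_le := (isPi0_level_le n).comp
      (f := fun u : Presentation × ℕ × ℕ × ℕ => (u.1, u.2.1)) (by fun_prop)
    refine (rel ?_ ?_).2.and ((((rel ?_ ?_).and (rel ?_ ?_)).imp (isDelta0_eq ?_ ?_ _)).2.and
      ((((rel ?_ ?_).and (rel ?_ ?_)).imp (rel ?_ ?_)).2.and (lower_bound.2.and
      ((((rel ?_ ?_).and (rel ?_ ?_)).imp ((rel ?_ ?_).or (rel ?_ ?_))).2.and
        (level_le.mono one_le_two))))) <;> fun_prop
  · rw [isTree_and_height_le_iff]
    refine and_congr nonempty_subtype (forall₃_congr fun x y z => ?_)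
    simp only [Presentation.level_rel]
    refine and_congr Iff.rfl (and_congr (imp_congr Iff.rfl Subtype.ext_iff) (and_congr Iff.rfl
      (and_congr ?_ Iff.rfl)))
    exact ⟨fun ⟨w, h⟩ => ⟨w.1, w.2, h⟩, fun ⟨w, hw, h⟩ => ⟨⟨w, hw⟩, h⟩⟩

theorem isPi0_isTreeOfHeightLE (n : ℕ) : IsPi0 2 (Presentation.IsTreeOfHeightLE n) :=
  isPi0_isValid.and (isPi0_isTree_and_height_le n)

theorem isPi0_forall_between :
    IsPi0 1 fun x : (Presentation × ℕ) × ℕ =>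
      ∀ w, x.1.1.natRel x.1.2 w ∧ x.1.1.natRel w x.2 → w = x.1.2 ∨ w = x.2 := by
  refine IsPi0.forall (IsPi0.imp (IsSigma0.and ?_ ?_) (IsPi0.or ?_ ?_))
  · exact isSigma0_natRel (by fun_prop) (by fun_prop) (by fun_prop)
  · exact isSigma0_natRel (by fun_prop) (by fun_prop) (by fun_prop)
  · exact (isDelta0_eq (by fun_prop) (by fun_prop) _).2
  · exact (isDelta0_eq (by fun_prop) (by fun_prop) _).2

theorem isSigma0_childOf (k : ℕ) :
    IsSigma0 (2 * k + 1) fun x : (Presentation × ℕ) × ℕ => ChildOf k x.1 x.2 := by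
  refine ((isSigma0_natRel (by fun_prop) (by fun_prop) (by fun_prop)).mono (by lia)).and
    ((isDelta0_eq (by fun_prop) (by fun_prop) _).not.1.and ?_)
  rcases Nat.eq_zero_or_pos k with rfl | hk
  · exact (isDelta0_of_computablePred (computablePred_const True) _).1.of_iff
      (by simp)
  · simpa only [hk.ne', ne_eq, not_false_eq_true, forall_const] using
      (isPi0_forall_between.isDelta0 (by lia : 1 < 2 * k + 1)).1

theorem isPi0_coneMatching (k : ℕ) :
    IsPi0 (2 * k) fun x : (Presentation × ℕ) × Presentation × ℕ => ConeMatching k x.1 x.2 := by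
  induction k with
  | zero =>
    exact (isDelta0_of_computablePred (computablePred_const True) _).2.of_iff
      (by simp [ConeMatching])
  | succ k ih =>
    have hchild₁ := (isSigma0_childOf k).comp
      (f := fun x : ((Presentation × ℕ) × Presentation × ℕ) × ℕ => (x.1.1, x.2)) (by fun_prop)
    have hchild₂ := (isSigma0_childOf k).comp
      (f := fun x : ((Presentation × ℕ) × Presentation × ℕ) × ℕ => (x.1.2, x.2)) (by fun_prop)
    refine (isPi0_listMatching hchild₁ hchild₂ ?_).and (isPi0_listMatching hchild₂ hchild₁ ?_)
    · exact ih.sigma_succ.comp (f := fun x : ((Presentation × ℕ) × Presentation × ℕ) × ℕ × ℕ =>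
        ((x.1.1.1, x.2.1), (x.1.2.1, x.2.2))) (by fun_prop)
    · exact ih.sigma_succ.comp (f := fun x : ((Presentation × ℕ) × Presentation × ℕ) × ℕ × ℕ =>
        ((x.1.1.1, x.2.2), (x.1.2.1, x.2.1))) (by fun_prop)

theorem isSigma0_isMinimalNode :
    IsSigma0 2 fun x : Presentation × ℕ => IsMinimalNode x.1 x.2 := by
  refine IsSigma0.and (isSigma0_accepts (by fun_prop) (by fun_prop)).succ
    (IsPi0.sigma_succ (IsPi0.forall (IsPi0.imp ?_ ?_)))
  · exact isSigma0_natRel (by fun_prop) (by fun_prop) (by fun_prop)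
  · exact (isDelta0_eq (by fun_prop) (by fun_prop) _).2

theorem isPi0_isoProblem {n : ℕ} (hn : 1 ≤ n) : IsPi0 (2 * n) (IsoProblem n) := by
  have htree : IsPi0 (2 * n) (Presentation.IsTreeOfHeightLE n) :=
    (isPi0_isTreeOfHeightLE n).mono (by lia)
  have hmatching : IsPi0 (2 * n) fun p : Presentation × Presentation => ∀ x : ℕ × ℕ,
      IsMinimalNode p.1 x.1 ∧ IsMinimalNode p.2 x.2 → ConeMatching n (p.1, x.1) (p.2, x.2) := by
    obtain ⟨k, rfl⟩ : ∃ k, n = k + 1 := Nat.exists_eq_add_of_le' hn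
    refine IsPi0.forall (IsPi0.imp ((IsSigma0.and ?_ ?_).mono (by lia : 2 ≤ 2 * k + 2)) ?_)
    · exact isSigma0_isMinimalNode.comp
        (f := fun x : (Presentation × Presentation) × ℕ × ℕ => (x.1.1, x.2.1)) (by fun_prop)
    · exact isSigma0_isMinimalNode.comp
        (f := fun x : (Presentation × Presentation) × ℕ × ℕ => (x.1.2, x.2.2)) (by fun_prop)
    · exact (isPi0_coneMatching (k + 1)).comp
        (f := fun x : (Presentation × Presentation) × ℕ × ℕ => ((x.1.1, x.2.1), (x.1.2, x.2.2)))
        (by fun_prop)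
  refine ((htree.comp Computable.fst).and ((htree.comp Computable.snd).and hmatching)).of_iff
    fun p => and_congr_right fun h₁ => and_congr_right fun h₂ => ?_
  rw [iso_iff_coneMatching h₁ h₂, Prod.forall]

end Complexity

/-! ## Trees coding nested infinity quantifiers -/

section PrefixOrder

variable {α V : Type} {le : V → V → Prop}

theorem isTree_of_prefix (g : le ↪r ((· <+: ·) : List α → List α → Prop)) (h : ∃ r, g r = []) :
    IsTree le where
  refl x := g.map_rel_iff.1 List.prefix_rfl
  antisymm x y hxy hyx := g.injective <|
    (g.map_rel_iff.2 hxy).eq_of_length_le (g.map_rel_iff.2 hyx).length_le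
  trans x y z hxy hyz := g.map_rel_iff.1 ((g.map_rel_iff.2 hxy).trans (g.map_rel_iff.2 hyz))
  exists_root := h.imp fun _ hr _ => g.map_rel_iff.1 (by simp [hr])
  finite_ancestors x := by
    refine ((g x).inits.finite_toSet.preimage g.injective.injOn).subset fun y hy => ?_
    simpa using g.map_rel_iff.2 hy
  linear_ancestors x y z hy hz := by
    simpa only [g.map_rel_iff] using
      List.prefix_or_prefix_of_prefix (g.map_rel_iff.2 hy) (g.map_rel_iff.2 hz)

theorem height_le_of_prefix (g : le ↪r ((· <+: ·) : List α → List α → Prop)) {n : ℕ}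
    (hn : ∀ x, (g x).length ≤ n) : height le ≤ n := by
  refine iSup_le fun x => le_trans ?_ (Nat.cast_le.2 (hn x))
  have length_injOn : Set.InjOn (fun y => (g y).length) {y | le y x ∧ y ≠ x} :=
    fun y hy z hz hyz => g.injective <| (List.prefix_of_prefix_length_le
      (g.map_rel_iff.2 hy.1) (g.map_rel_iff.2 hz.1) hyz.le).eq_of_length hyz
  have length_lt : (fun y => (g y).length) '' {y | le y x ∧ y ≠ x} ⊆ Set.Iio (g x).length := by
    rintro _ ⟨y, ⟨hy, hyx⟩, rfl⟩
    have hpre := g.map_rel_iff.2 hy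
    exact hpre.length_le.lt_of_ne fun h => hyx (g.injective (hpre.eq_of_length h))
  rw [level, ← length_injOn.encard_image]
  exact (Set.encard_le_encard length_lt).trans (by simp [Set.encard_eq_coe_toFinset_card])

end PrefixOrder

section InfQuant

/-- `InfQuant k R`: there are infinitely many `b₁` such that there are infinitely many `b₂`
such that … there are infinitely many `b_k` with `R [b₁, …, b_k]`. -/
def InfQuant : ℕ → (List ℕ → Prop) → Prop
  | 0, R => R []
  | k + 1, R => {b | InfQuant k fun s => R (b :: s)}.Infinite

/-- The predicate on lists whose first entry exists and is below `m`. -/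
def HeadLT (m : ℕ) (s : List ℕ) : Prop := ∃ c ∈ s.head?, c < m

/-- The predicate coded by the cone above the `b`-th child of the root of the tree coding `R`:
the even children code the sections of `R`, and the odd ones the predicates `HeadLT m`, each of
them infinitely often. -/
def childPred (R : List ℕ → Prop) (b : ℕ) : List ℕ → Prop :=
  if b % 2 = 0 then fun s => R (b / 2 :: s) else HeadLT (b / 2).unpair.1

/-- The number of `b` with `InfQuant k fun s => R (b :: s)`, a complete invariant for isomorphism
of the trees coding predicates of `k + 1` variables. Predicates of no variables, which are coded by
a tree that is empty or a point, get the values `0` and `⊤`. -/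
noncomputable def infCount : ℕ → (List ℕ → Prop) → ℕ∞
  | 0, R => by classical exact if R [] then ⊤ else 0
  | k + 1, R => {b | InfQuant k fun s => R (b :: s)}.encard

variable {k : ℕ} {R R' : List ℕ → Prop}

theorem infQuant_const {p : Prop} : InfQuant k (fun _ => p) ↔ p := by
  induction k with
  | zero => rfl
  | succ k ih =>
    simp only [InfQuant, ih]
    by_cases hp : p <;> simp [hp, Set.infinite_univ]

theorem setOf_infQuant_headLT (k m : ℕ) :
    {b | InfQuant k fun s => HeadLT m (b :: s)} = Set.Iio m := by
  ext b
  simp [HeadLT, infQuant_const]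

theorem not_infQuant_headLT (k m : ℕ) : ¬ InfQuant k (HeadLT m) := by
  cases k with
  | zero => simp [InfQuant, HeadLT]
  | succ k =>
    rw [InfQuant, setOf_infQuant_headLT]
    exact Set.not_infinite.2 (Set.finite_Iio m)

theorem setOf_infQuant_childPred (k : ℕ) (R : List ℕ → Prop) :
    {b | InfQuant k (childPred R b)} = (2 * ·) '' {c | InfQuant k fun s => R (c :: s)} := by
  ext b
  simp only [Set.mem_ofPred_eq, Set.mem_image, childPred]
  split_ifs with hb
  · refine ⟨fun h => ⟨b / 2, h, by omega⟩, ?_⟩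
    rintro ⟨c, hc, rfl⟩
    simpa using hc
  · refine iff_of_false (not_infQuant_headLT _ _) ?_
    rintro ⟨c, -, rfl⟩
    omega

theorem encard_setOf_infQuant_childPred (k : ℕ) (R : List ℕ → Prop) :
    {b | InfQuant k (childPred R b)}.encard = infCount (k + 1) R := by
  rw [setOf_infQuant_childPred]
  exact (mul_right_injective₀ two_ne_zero).encard_image _

theorem infCount_eq_top_iff : infCount k R = ⊤ ↔ InfQuant k R := by
  cases k with
  | zero => by_cases h : R [] <;> simp [infCount, InfQuant, h]
  | succ k => simp [infCount, InfQuant]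

theorem infinite_setOf_infQuant_childPred_iff :
    {b | InfQuant k (childPred R b)}.Infinite ↔ InfQuant (k + 1) R := by
  rw [← Set.encard_eq_top_iff, encard_setOf_infQuant_childPred, infCount_eq_top_iff]

theorem infCount_succ_headLT (k m : ℕ) : infCount (k + 1) (HeadLT m) = m := by
  simp [infCount, setOf_infQuant_headLT, Set.encard_eq_coe_toFinset_card]

theorem encard_fiber_infCount_childPred_natCast (k m : ℕ) (R : List ℕ → Prop) :
    ((fun b => infCount k (childPred R b)) ⁻¹' {(m : ℕ∞)}).encard =
      if k = 0 ∧ m ≠ 0 then 0 else ⊤ := by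
  split_ifs with h
  · obtain ⟨rfl, hm⟩ := h
    rw [Set.encard_eq_zero, Set.eq_empty_iff_forall_notMem]
    intro b hb
    by_cases hR : childPred R b [] <;> simp [infCount, hR, eq_comm, hm] at hb
  · rw [Set.encard_eq_top_iff]
    refine Set.infinite_of_injective_forall_mem (f := fun i => 2 * Nat.pair m i + 1)
      (fun i j hij => by simpa using hij) fun i => ?_
    have mod_two : (2 * Nat.pair m i + 1) % 2 ≠ 0 := by omega
    have div_two : (2 * Nat.pair m i + 1) / 2 = Nat.pair m i := by omega
    have childPred_eq : childPred R (2 * Nat.pair m i + 1) = HeadLT m := by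
      rw [childPred, if_neg mod_two, div_two, Nat.unpair_pair]
    rw [Set.mem_preimage, childPred_eq, Set.mem_singleton_iff]
    cases k with
    | zero => simp_all [infCount, HeadLT]
    | succ k => exact infCount_succ_headLT k m

theorem encard_fiber_infCount_childPred_congr (h : infCount (k + 1) R = infCount (k + 1) R')
    (c : ℕ∞) : ((fun b => infCount k (childPred R b)) ⁻¹' {c}).encard =
      ((fun b => infCount k (childPred R' b)) ⁻¹' {c}).encard := by
  induction c using ENat.recTopCoe with
  | top =>
    have fiber_top (S : List ℕ → Prop) : (fun b => infCount k (childPred S b)) ⁻¹' {⊤} =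
        {b | InfQuant k (childPred S b)} := Set.ext fun b => infCount_eq_top_iff
    rwa [fiber_top, fiber_top, encard_setOf_infQuant_childPred, encard_setOf_infQuant_childPred]
  | coe m => simp only [encard_fiber_infCount_childPred_natCast]

end InfQuant

section CodingTree

/-- The predicate coded by the cone above the node `s` of the tree coding `R`. -/
def nodePred (R : List ℕ → Prop) (s : List ℕ) : List ℕ → Prop := s.foldl childPred R

/-- The nodes of the tree coding the predicate `R` of `k` variables: the lists of length less than
`k`, and those lists of length `k` at which the coded predicate holds. -/
def IsNode (k : ℕ) (R : List ℕ → Prop) (s : List ℕ) : Prop :=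
  s.length < k ∨ s.length = k ∧ nodePred R s []

/-- The tree coding the predicate `R` of `k` variables, ordered by the prefix relation. -/
@[ext]
structure CodingTree (k : ℕ) (R : List ℕ → Prop) : Type where
  word : List ℕ
  isNode : IsNode k R word

instance (k : ℕ) (R : List ℕ → Prop) : PartialOrder (CodingTree k R) where
  le x y := x.word <+: y.word
  le_refl _ := List.prefix_rfl
  le_trans _ _ _ := List.IsPrefix.trans
  le_antisymm _ _ hxy hyx := CodingTree.ext (hxy.eq_of_length_le hyx.length_le)

variable {k n : ℕ} {R R' : List ℕ → Prop} {s : List ℕ} {b : ℕ}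

theorem isNode_nil (hk : 1 ≤ k) : IsNode k R [] := Or.inl hk

theorem IsNode.length_le (h : IsNode k R s) : s.length ≤ k := h.elim le_of_lt fun h => h.1.le

theorem IsNode.of_prefix {t : List ℕ} (ht : IsNode k R t) (h : s <+: t) : IsNode k R s := by
  rcases h.length_le.lt_or_eq with hlt | heq
  · exact Or.inl (hlt.trans_le ht.length_le)
  · rwa [h.eq_of_length heq]

theorem isNode_cons_iff : IsNode (k + 1) R (b :: s) ↔ IsNode k (childPred R b) s := by
  simp [IsNode, nodePred]

theorem isNode_of_infQuant (h : s.length + k = n) (hs : InfQuant k (nodePred R s)) :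
    IsNode n R s := by
  cases k with
  | zero => exact Or.inr ⟨h, hs⟩
  | succ k => exact Or.inl (by omega)

namespace CodingTree

theorem word_injective : (word (k := k) (R := R)).Injective := fun _ _ => CodingTree.ext

/-- The decomposition of a coding tree into its root and the coding trees above the children of
the root. -/
def ofWithBot : WithBot (Σ b, CodingTree k (childPred R b)) → CodingTree (k + 1) R
  | ⊥ => ⟨[], isNode_nil (by omega)⟩
  | WithBot.some ⟨b, x⟩ => ⟨b :: x.word, isNode_cons_iff.2 x.isNode⟩

theorem ofWithBot_surjective : (ofWithBot (k := k) (R := R)).Surjective := by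
  rintro ⟨_ | ⟨b, s⟩, hs⟩
  · exact ⟨⊥, rfl⟩
  · exact ⟨(⟨b, s, isNode_cons_iff.1 hs⟩ : Σ b, CodingTree k (childPred R b)), rfl⟩

theorem ofWithBot_le_ofWithBot_iff {x y : WithBot (Σ b, CodingTree k (childPred R b))} :
    ofWithBot x ≤ ofWithBot y ↔ x ≤ y := by
  induction x with
  | bot => exact iff_of_true List.nil_prefix bot_le
  | coe x =>
    induction y with
    | bot => exact iff_of_false (by simp [ofWithBot, LE.le]) (WithBot.not_coe_le_bot x)
    | coe y =>
      obtain ⟨b, x⟩ := x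
      obtain ⟨c, y⟩ := y
      rw [WithBot.coe_le_coe]
      refine List.cons_prefix_cons.trans ⟨?_, fun h => ?_⟩
      · rintro ⟨rfl, hxy⟩
        exact Sigma.LE.fiber _ _ _ hxy
      · obtain ⟨_, _, _, hxy⟩ := h
        exact ⟨rfl, hxy⟩

theorem nonempty_withBot_sigma_orderIso (k : ℕ) (R : List ℕ → Prop) :
    Nonempty (WithBot (Σ b, CodingTree k (childPred R b)) ≃o CodingTree (k + 1) R) :=
  ⟨RelIso.ofSurjective
    (OrderEmbedding.ofMapLEIff ofWithBot fun _ _ => ofWithBot_le_ofWithBot_iff)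
    ofWithBot_surjective⟩

theorem nonempty_orderIso_of_infCount_eq (h : infCount k R = infCount k R') :
    Nonempty (CodingTree k R ≃o CodingTree k R') := by
  induction k generalizing R R' with
  | zero =>
    have hR : R [] ↔ R' [] := by
      simpa only [infCount_eq_top_iff, InfQuant, eq_iff_iff] using congrArg (· = ⊤) h
    have isNode_iff (s : List ℕ) : IsNode 0 R s ↔ IsNode 0 R' s := by
      cases s <;> simp [IsNode, nodePred, hR]
    exact ⟨⟨⟨fun x => ⟨x.word, (isNode_iff _).1 x.isNode⟩,
      fun x => ⟨x.word, (isNode_iff _).2 x.isNode⟩, fun _ => rfl, fun _ => rfl⟩, Iff.rfl⟩⟩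
  | succ k ih =>
    obtain ⟨e, he⟩ := exists_equiv_of_encard_fiber_eq _ _ (encard_fiber_infCount_childPred_congr h)
    obtain ⟨φ⟩ := nonempty_withBot_sigma_orderIso k R
    obtain ⟨ψ⟩ := nonempty_withBot_sigma_orderIso k R'
    obtain ⟨χ⟩ := RecTree.nonempty_withBot_sigma_orderIso
      (S := fun b => CodingTree k (childPred R b)) (T := fun b => CodingTree k (childPred R' b)) e
      fun b => ih (he b).symm
    exact ⟨(φ.symm.trans χ).trans ψ⟩

theorem length_strictMono : StrictMono fun x : CodingTree k R => x.word.length :=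
  fun _ _ hxy => hxy.le.length_le.lt_of_ne fun h => hxy.ne (CodingTree.ext (hxy.le.eq_of_length h))

theorem covBy_iff {x y : CodingTree k R} : x ⋖ y ↔ ∃ b, x.word ++ [b] = y.word := by
  constructor
  · intro h
    obtain ⟨_ | ⟨b, t⟩, ht⟩ := h.le
    · exact absurd (CodingTree.ext (by simpa using ht)) h.ne
    · have hby : x.word ++ [b] <+: y.word := ⟨t, by simpa using ht⟩
      let z : CodingTree k R := ⟨x.word ++ [b], y.isNode.of_prefix hby⟩
      rcases h.eq_or_eq (c := z) (List.prefix_append _ _) hby with hz | hz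
      · simpa [z] using congrArg word hz
      · exact ⟨b, congrArg word hz⟩
  · rintro ⟨b, hb⟩
    have length_eq : y.word.length = x.word.length + 1 := by simp [← hb]
    refine ⟨lt_of_le_of_ne ⟨[b], hb⟩ ?_, fun z hxz hzy => ?_⟩
    · rintro rfl
      omega
    · have hxz : x.word.length < z.word.length := length_strictMono hxz
      have hzy : z.word.length < y.word.length := length_strictMono hzy
      omega

end CodingTree

/-- An isomorphism invariant of nodes: `x` has infinitely many children that have infinitely many
children that have … infinitely many children, `k` levels deep. -/
def InfBranching {V : Type} [LT V] : ℕ → V → Prop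
  | 0, _ => True
  | k + 1, x => {y | x ⋖ y ∧ InfBranching k y}.Infinite

theorem infBranching_apply_iff {V W : Type} [Preorder V] [Preorder W] (e : V ≃o W) {x : V} :
    InfBranching k (e x) ↔ InfBranching k x := by
  induction k generalizing x with
  | zero => rfl
  | succ k ih =>
    have image_eq : {y | e x ⋖ y ∧ InfBranching k y} =
        e '' {y | x ⋖ y ∧ InfBranching k y} := by
      ext y
      obtain ⟨y, rfl⟩ := e.surjective y
      simp [apply_covBy_apply_iff e, ih]
    rw [InfBranching, image_eq, Set.infinite_image_iff e.injective.injOn]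
    rfl

namespace CodingTree

theorem infBranching_iff {x : CodingTree n R} (h : x.word.length + k = n) :
    InfBranching k x ↔ InfQuant k (nodePred R x.word) := by
  induction k generalizing x with
  | zero => exact iff_of_true trivial (x.isNode.resolve_left (by omega)).2
  | succ k ih =>
    have nodePred_concat (b : ℕ) :
        nodePred R (x.word ++ [b]) = childPred (nodePred R x.word) b := by
      simp [nodePred]
    have length_concat (b : ℕ) : (x.word ++ [b]).length + k = n := by
      simp
      omega
    have image_eq : word '' {y : CodingTree n R | x ⋖ y ∧ InfBranching k y} =
        (fun b => x.word ++ [b]) '' {b | InfQuant k (childPred (nodePred R x.word) b)} := by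
      ext s
      constructor
      · rintro ⟨y, ⟨hxy, hy⟩, rfl⟩
        obtain ⟨b, hb⟩ := covBy_iff.1 hxy
        refine ⟨b, ?_, hb⟩
        rwa [ih (hb ▸ length_concat b), ← hb, nodePred_concat] at hy
      · rintro ⟨b, hb, rfl⟩
        rw [Set.mem_ofPred_eq, ← nodePred_concat] at hb
        let y : CodingTree n R := ⟨x.word ++ [b], isNode_of_infQuant (length_concat b) hb⟩
        exact ⟨y, ⟨covBy_iff.2 ⟨b, rfl⟩, (ih (length_concat b)).2 hb⟩, rfl⟩
    rw [InfBranching, ← Set.infinite_image_iff word_injective.injOn, image_eq,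
      Set.infinite_image_iff (fun b _ c _ hbc => by simpa using hbc),
      infinite_setOf_infQuant_childPred_iff]

theorem nonempty_orderIso_true_iff (hn : 1 ≤ n) :
    Nonempty (CodingTree n R ≃o CodingTree n fun _ => True) ↔ InfQuant n R := by
  constructor
  · rintro ⟨e⟩
    let root (R : List ℕ → Prop) : CodingTree n R := ⟨[], isNode_nil hn⟩
    have isBot_root (R : List ℕ → Prop) : IsBot (root R) := fun _ => List.nil_prefix
    have infBranching_root (R : List ℕ → Prop) : InfBranching n (root R) ↔ InfQuant n R :=
      infBranching_iff (by simp [root])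
    have map_root : e (root R) = root _ :=
      le_antisymm (e.le_symm_apply.1 (isBot_root R _)) (isBot_root _ _)
    rw [← infBranching_root, ← infBranching_apply_iff e, map_root, infBranching_root]
    exact infQuant_const.2 trivial
  · intro h
    refine nonempty_orderIso_of_infCount_eq ?_
    rw [infCount_eq_top_iff.2 h, infCount_eq_top_iff.2 (infQuant_const.2 trivial)]

end CodingTree

end CodingTree

/-! ## Reducing `Π⁰_{2n}` sets to the isomorphism problem -/

section LowerBound

variable {α : Type} [Primcodable α]

theorem IsPi0.exists_infQuant {k : ℕ} {p : α → Prop} (hp : IsPi0 (2 * k) p) :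
    ∃ R : α → List ℕ → Prop, ComputablePred (fun x : α × List ℕ => R x.1 x.2) ∧
      ∀ a, p a ↔ InfQuant k (R a) := by
  induction k generalizing α with
  | zero =>
    exact ⟨fun a _ => p a, computablePred_comp (isPi0_zero_iff.1 hp) Computable.fst,
      fun a => Iff.rfl⟩
  | succ k ih =>
    obtain ⟨q, hq, hpq⟩ := IsPi0.exists_infinite (k := 2 * k) hp
    obtain ⟨R, hR, hqR⟩ := ih hq
    refine ⟨fun a s => R (a, s.headI) s.tail, ?_, fun a => ?_⟩
    · have headI_computable := Primrec.list_headI (α := ℕ).to_comp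
      have tail_computable := Primrec.list_tail (α := ℕ).to_comp
      exact computablePred_comp (f := fun x : α × List ℕ => ((x.1, x.2.headI), x.2.tail)) hR
        (by fun_prop)
    · rw [hpq, InfQuant]
      exact iff_of_eq (congrArg Set.Infinite (Set.ext fun b => hqR (a, b)))

/-- The predicate with code `σ`: the code `(none, l)` stands for the section of `R` at `l`, and
the code `(some m, l)` for the section of `HeadLT m` at `l`. All predicates `nodePred R s` are of
this form, with a code that can be computed from `s` alone. -/
def codePred (R : List ℕ → Prop) : Option ℕ × List ℕ → List ℕ → Prop
  | (none, l), t => R (l ++ t)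
  | (some m, l), t => HeadLT m (l ++ t)

/-- The operation on codes that corresponds to `childPred`. -/
def childCode (σ : Option ℕ × List ℕ) (b : ℕ) : Option ℕ × List ℕ :=
  if b % 2 = 0 then (σ.1, σ.2 ++ [b / 2]) else (some (b / 2).unpair.1, [])

/-- The operation on codes that corresponds to `nodePred`, applied to the code of `R`. -/
def nodeCode (s : List ℕ) : Option ℕ × List ℕ := s.foldl childCode (none, [])

theorem childPred_codePred (R : List ℕ → Prop) (σ : Option ℕ × List ℕ) (b : ℕ) :
    childPred (codePred R σ) b = codePred R (childCode σ b) := by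
  rcases σ with ⟨_ | m, l⟩ <;> by_cases hb : b % 2 = 0 <;> funext t <;>
    simp [childPred, childCode, codePred, hb]

theorem nodePred_eq_codePred (R : List ℕ → Prop) (s : List ℕ) :
    nodePred R s = codePred R (nodeCode s) :=
  List.foldl_hom (init := (none, [])) (codePred R) fun σ b => (childPred_codePred R σ b)

theorem nodePred_nil_iff (R : List ℕ → Prop) (s : List ℕ) :
    nodePred R s [] ↔ ((nodeCode s).1 = none ∧ R (nodeCode s).2) ∨
      ((nodeCode s).2 ≠ [] ∧ (nodeCode s).2.headI < (nodeCode s).1.getD 0) := by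
  rw [nodePred_eq_codePred]
  rcases nodeCode s with ⟨_ | m, _ | ⟨c, l⟩⟩ <;> simp [codePred, HeadLT]

theorem primrec_nodeCode : Primrec nodeCode := by
  refine Primrec.list_foldl (h := fun (_ : List ℕ) (x : (Option ℕ × List ℕ) × ℕ) =>
    childCode x.1 x.2) Primrec.id (Primrec.const _) ?_
  have code : Primrec fun y : List ℕ × (Option ℕ × List ℕ) × ℕ => y.2.1 :=
    Primrec.fst.comp Primrec.snd
  have entry : Primrec fun y : List ℕ × (Option ℕ × List ℕ) × ℕ => y.2.2 :=
    Primrec.snd.comp Primrec.snd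
  have half := Primrec.nat_div.comp entry (Primrec.const 2)
  exact Primrec.ite (Primrec.eq.comp (Primrec.nat_mod.comp entry (Primrec.const 2))
      (Primrec.const 0))
    ((Primrec.fst.comp code).pair (Primrec.list_append.comp (Primrec.snd.comp code)
      (Primrec.list_cons.comp half (Primrec.const []))))
    ((Primrec.option_some.comp (Primrec.fst.comp (Primrec.unpair.comp half))).pair
      (Primrec.const []))

theorem computablePred_isNode {R : α → List ℕ → Prop}
    (hR : ComputablePred fun x : α × List ℕ => R x.1 x.2) (n : ℕ) :
    ComputablePred fun x : α × List ℕ => IsNode n (R x.1) x.2 := by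
  have nodeCode_computable := primrec_nodeCode.to_comp
  have headI_computable := Primrec.list_headI (α := ℕ).to_comp
  have bound_computable : Computable fun x : α × List ℕ => (nodeCode x.2).1.getD 0 :=
    Primrec.option_getD.to_comp.comp (by fun_prop) (Computable.const 0)
  simp only [IsNode, nodePred_nil_iff]
  refine computablePred_or (computablePred_lt (by fun_prop) (by fun_prop)) <|
    computablePred_and (computablePred_eq (by fun_prop) (by fun_prop)) <| computablePred_or
      (computablePred_and (computablePred_eq (by fun_prop) (by fun_prop)) ?_)
      (computablePred_and (computablePred_eq (by fun_prop) (by fun_prop)).not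
        (computablePred_lt (by fun_prop) bound_computable))
  exact computablePred_comp (f := fun x : α × List ℕ => (x.1, (nodeCode x.2).2)) hR (by fun_prop)

theorem computablePred_prefix :
    ComputablePred fun x : List α × List α => x.1 <+: x.2 := by
  have take_computable : Computable fun x : List α × List α => x.2.take x.1.length :=
    (Primrec.list_take.comp (Primrec.list_length.comp Primrec.fst) Primrec.snd).to_comp
  exact (computablePred_eq Computable.fst take_computable).of_eq fun x =>
    List.prefix_iff_eq_take.symm

theorem exists_deciders {D : ℕ → ℕ → Prop} (hD : ComputablePred fun x : ℕ × ℕ => D x.1 x.2) :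
    ∃ g : ℕ → Code, Computable g ∧ ∀ x, IsDecider (g x) ∧ ∀ v, Accepts (g x) v ↔ D x v := by
  classical
  obtain ⟨c, hc⟩ := Code.exists_code.1 <| Partrec.nat_iff.1 <| Computable.partrec <|
    Computable.cond (hD.decide.comp Computable.unpair) (Computable.const 1) (Computable.const 0)
  have eval_curry (x v : ℕ) : (c.curry x).eval v = Part.some (if D x v then 1 else 0) := by
    simp [Code.eval_curry, hc, Bool.cond_decide]
  refine ⟨c.curry, (Code.primrec₂_curry.comp (Primrec.const c) Primrec.id).to_comp,
    fun x => ⟨fun v => ?_, fun v => ?_⟩⟩ <;>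
  by_cases h : D x v <;> simp [Accepts, Rejects, eval_curry, h]

theorem exists_presents {β : Type} [Denumerable β] {r : β → β → Prop} {V : ℕ → Type}
    {s : ∀ x, V x → V x → Prop} (g : ∀ x, s x ↪r r)
    (hr : ComputablePred fun x : β × β => r x.1 x.2)
    (hg : ComputablePred fun x : ℕ × β => x.2 ∈ Set.range (g x.1)) :
    ∃ f : ℕ → Presentation, Computable f ∧ ∀ x, (f x).IsValid ∧
      Presents (f x) (s x) (fun a => Encodable.encode (g x a)) := by
  let decode := Denumerable.ofNat β
  let D (x v : ℕ) : Prop := decode v ∈ Set.range (g x)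
  let E (x v : ℕ) : Prop :=
    (D x v.unpair.1 ∧ D x v.unpair.2) ∧ r (decode v.unpair.1) (decode v.unpair.2)
  have hD : ComputablePred fun x : ℕ × ℕ => D x.1 x.2 :=
    computablePred_comp (f := fun x : ℕ × ℕ => (x.1, decode x.2)) hg (by fun_prop)
  have hE : ComputablePred fun x : ℕ × ℕ => E x.1 x.2 :=
    computablePred_and (computablePred_and
      (computablePred_comp (f := fun x : ℕ × ℕ => (x.1, x.2.unpair.1)) hD (by fun_prop))
      (computablePred_comp (f := fun x : ℕ × ℕ => (x.1, x.2.unpair.2)) hD (by fun_prop)))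
      (computablePred_comp (f := fun x : ℕ × ℕ => (decode x.2.unpair.1, decode x.2.unpair.2)) hr
        (by fun_prop))
  obtain ⟨c, hc, hcD⟩ := exists_deciders hD
  obtain ⟨d, hd, hdE⟩ := exists_deciders hE
  have mem_range_iff (x v : ℕ) : D x v ↔ ∃ a, Encodable.encode (g x a) = v :=
    exists_congr fun a => ⟨fun h => by simp [h, decode], fun h => by simp [← h, decode]⟩
  refine ⟨fun x => (c x, d x), by fun_prop, fun x => ⟨⟨(hcD x).1, (hdE x).1, fun v w hvw => ?_⟩,
    ⟨fun a b hab => (g x).injective (Encodable.encode_injective hab),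
      fun v => ((hcD x).2 v).trans (mem_range_iff x v), fun v w => ?_⟩⟩⟩
  · rw [(hdE x).2] at hvw
    simpa [(hcD x).2, E] using hvw.1
  · rw [Presentation.natRel, (hdE x).2]
    simp only [E, Nat.unpair_pair, mem_range_iff]
    constructor
    · rintro ⟨⟨⟨a, rfl⟩, ⟨b, rfl⟩⟩, hab⟩
      exact ⟨a, b, (g x).map_rel_iff.1 (by simpa [decode] using hab), rfl, rfl⟩
    · rintro ⟨a, b, hab, rfl, rfl⟩
      exact ⟨⟨⟨a, rfl⟩, ⟨b, rfl⟩⟩, by simpa [decode] using (g x).map_rel_iff.2 hab⟩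

theorem exists_presentations {R : ℕ → List ℕ → Prop}
    (hR : ComputablePred fun x : ℕ × List ℕ => R x.1 x.2) {n : ℕ} (hn : 1 ≤ n) :
    ∃ f : ℕ → Presentation, Computable f ∧ ∀ x, (f x).IsTreeOfHeightLE n ∧
      Nonempty ((f x).rel ≃r ((· ≤ ·) : CodingTree n (R x) → CodingTree n (R x) → Prop)) := by
  let g (x : ℕ) : ((· ≤ ·) : CodingTree n (R x) → CodingTree n (R x) → Prop) ↪r (· <+: ·) :=
    ⟨⟨CodingTree.word, CodingTree.word_injective⟩, Iff.rfl⟩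
  have mem_range_iff (x : ℕ) (s : List ℕ) : s ∈ Set.range (g x) ↔ IsNode n (R x) s :=
    ⟨fun ⟨a, ha⟩ => ha ▸ a.isNode, fun hs => ⟨⟨s, hs⟩, rfl⟩⟩
  obtain ⟨f, hf, hfg⟩ := exists_presents g computablePred_prefix
    ((computablePred_isNode hR n).of_eq fun x => (mem_range_iff x.1 x.2).symm)
  refine ⟨f, hf, fun x => ?_⟩
  obtain ⟨e⟩ := (hfg x).2.nonempty_relIso
  let eg := e.toRelEmbedding.trans (g x)
  have exists_root : ∃ r, eg r = [] :=
    ⟨e.symm ⟨[], isNode_nil hn⟩, congrArg CodingTree.word (e.apply_symm_apply _)⟩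
  exact ⟨⟨(hfg x).1, isTree_of_prefix eg exists_root,
    height_le_of_prefix eg fun a => (e a).isNode.length_le⟩, ⟨e⟩⟩

theorem exists_reduction {n : ℕ} (hn : 1 ≤ n) {B : ℕ → Prop} (hB : IsPi0 (2 * n) B) :
    ∃ f : ℕ → Presentation × Presentation, Computable f ∧
      (∀ x, (f x).1.IsTreeOfHeightLE n ∧ (f x).2.IsTreeOfHeightLE n) ∧
      ∀ x, B x ↔ (f x).1.Iso (f x).2 := by
  obtain ⟨R, hR, hBR⟩ := hB.exists_infQuant
  obtain ⟨f, hf, hfR⟩ := exists_presentations hR hn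
  obtain ⟨g, hg, hgT⟩ := exists_presentations (R := fun _ _ => True) (computablePred_const True) hn
  refine ⟨fun x => (f x, g x), hf.pair hg, fun x => ⟨(hfR x).1, (hgT x).1⟩, fun x => ?_⟩
  obtain ⟨φ⟩ := (hfR x).2
  obtain ⟨ψ⟩ := (hgT x).2
  rw [hBR, ← CodingTree.nonempty_orderIso_true_iff hn]
  exact ⟨fun ⟨e⟩ => ⟨(φ.trans e).trans ψ.symm⟩, fun ⟨e⟩ => ⟨(φ.symm.trans e).trans ψ⟩⟩

end LowerBound

end RecTree

/-- The isomorphism problem for recursive trees of height at most `n` is `Π⁰_{2n}`-complete, and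
hardness holds already for pairs that are presentations of recursive trees of height at
most `n`. -/
theorem theorem5p1 (n : ℕ) (hn : 1 ≤ n) :
    RecTree.IsPi0Complete (2 * n) (RecTree.IsoProblem n) ∧
    ∀ B : ℕ → Prop, RecTree.IsPi0 (2 * n) B →
      ∃ f : ℕ → RecTree.Presentation × RecTree.Presentation, Computable f ∧
        (∀ x, (f x).1.IsTreeOfHeightLE n ∧ (f x).2.IsTreeOfHeightLE n) ∧
        ∀ x, B x ↔ (f x).1.Iso (f x).2 := by
  refine ⟨⟨RecTree.isPi0_isoProblem hn, fun B hB => ?_⟩,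
    fun B hB => RecTree.exists_reduction hn hB⟩
  obtain ⟨f, hf, htree, hiso⟩ := RecTree.exists_reduction hn hB
  exact ⟨f, hf, fun x => (hiso x).trans
    ⟨fun h => ⟨(htree x).1, (htree x).2, h⟩, fun h => h.2.2⟩⟩
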